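/- **Error of the SDF encoding.** Let $Q=[0,1]^2$ and let $\emptyset\neq D\subseteq Q$ be a closed region with boundary $\Gamma=\partial D$ of class $C^2$ (near each point of $\Gamma$, $D$ is a sublevel set $\{f\le 0\}$ of a $C^2$ function $f$ whose differential does not vanish at that point). Let $\phi$ be the signed distance function of $\Gamma$, i.e. $\phi(x)=-\operatorname{dist}(x,\Gamma)$ for $x\in D$ and $\phi(x)=\operatorname{dist}(x,\Gamma)$ for $x\notin D$. Let the medial axis $M$ be the closure of the set of points of $\mathbb R^2$ that have at least two nearest points on $\Gamma$. Assume that $M\cap Q$ has finite length ($1$-dimensional Hausdorff measure) $L$ and finitely many, say $N$, connected components. For $n\ge 2$ let $h=1/(n-1)$, take the uniform $n\times n$ grid of points $(ih,jh)$, $0\le i,j\le n-1$, and let $\mathrm{grid}_n$ be the function on $Q$ that on each of the $(n-1)^2$ closed grid cells is the bilinear interpolant of the values of $\phi$ at the four corners. Put $E_n=\phi-\mathrm{grid}_n$. A cell is called singular if it meets $M$ and smooth otherwise. Then there is an absolute constant $A>0$ (independent of $D$ and $n$) such that: 1. There is a constant $C>0$ depending only on $D$ with $$\Big(\int_Q |E_n|^2\,dx\Big)^{1/2}\le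 C\,n^{-3/2}\qquad\text{for all } n\ge 2 .$$ 2. For every $n\ge2$ and every smooth cell $T$, $\phi$ is $C^2$ at each point of $T$, and there are $\xi,\eta\in T$ with $$|E_n(x)|\le \frac{h^2}{2}\big(|\phi_{xx}(\xi)|+|\phi_{yy}(\eta)|\big)\qquad\text{for all }x\in T .$$ 3. For every $n\ge2$ the number of singular cells is at most $A\,(L(n-1)+N)$. 4. For every $n\ge2$ and every singular cell $T$, $\displaystyle\int_T |E_n|^2\,dx\le A\,h^4$. 5. For every $n\ge2$ and every $K$ such that $|\phi_{xx}|+|\phi_{yy}|\le K$ on all smooth cells of the $n\times n$ grid, $$\int_Q |E_n|^2\,dx\le A\,(L(n-1)+N)\,h^4+(n-1)^2\Big(\frac K2\Big)^2h^6 .$$ -/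

import Mathlib

open MeasureTheory Topology
open scoped ENNReal

noncomputable section

namespace SDFEncoding

/-- The Euclidean plane. -/
abbrev Plane : Type := EuclideanSpace ℝ (Fin 2)

/-- The computational domain `[0,1]²`. -/
def unitSquare : Set Plane := {x | ∀ k, x k ∈ Set.Icc (0 : ℝ) 1}

/-- The boundary of `D` is of class `C²`: near each boundary point, `D` is the sublevel set
`{f ≤ 0}` of a `C²` function `f` whose differential does not vanish at that point. -/
def HasC2Boundary (D : Set Plane) : Prop :=
  ∀ p ∈ frontier D, ∃ f : Plane → ℝ, ContDiffAt ℝ 2 f p ∧ fderiv ℝ f p ≠ 0 ∧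
    ∀ᶠ x in 𝓝 p, (x ∈ D ↔ f x ≤ 0)

open Classical in
/-- The signed distance function of the interface `∂D`, negative in `D`, positive outside. -/
def sdf (D : Set Plane) (x : Plane) : ℝ :=
  if x ∈ D then -Metric.infDist x (frontier D) else Metric.infDist x (frontier D)

/-- The medial axis of the interface `∂D`: the closure of the set of points of the plane that
have at least two nearest points on `∂D`. -/
def medialAxis (D : Set Plane) : Set Plane :=
  closure {x | ∃ p ∈ frontier D, ∃ q ∈ frontier D, p ≠ q ∧
    dist x p = Metric.infDist x (frontier D) ∧ dist x q = Metric.infDist x (frontier D)}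

/-- The part of the medial axis in the computational domain. -/
def medialAxisInSquare (D : Set Plane) : Set Plane := medialAxis D ∩ unitSquare

/-- The length (one-dimensional Hausdorff measure) of the medial axis in the unit square. -/
def medialLength (D : Set Plane) : ℝ := (μH[1] (medialAxisInSquare D)).toReal

/-- The number of connected components of the medial axis in the unit square. -/
def medialComponents (D : Set Plane) : ℕ := Nat.card (ConnectedComponents (medialAxisInSquare D))

/-- The mesh size `h = 1 / (n - 1)` of the uniform `n × n` grid on `[0,1]²`. -/
def mesh (n : ℕ) : ℝ := 1 / ((n : ℝ) - 1)

/-- The grid point `(i h, j h)`, where `0 ≤ i, j ≤ n - 1`. -/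
def gridPoint (n i j : ℕ) : Plane := !₂[(i : ℝ) * mesh n, (j : ℝ) * mesh n]

/-- The closed grid cell `[i h, (i+1) h] × [j h, (j+1) h]`, where `0 ≤ i, j ≤ n - 2`. -/
def cell (n i j : ℕ) : Set Plane :=
  {x | x 0 ∈ Set.Icc ((i : ℝ) * mesh n) (((i : ℝ) + 1) * mesh n) ∧
    x 1 ∈ Set.Icc ((j : ℝ) * mesh n) (((j : ℝ) + 1) * mesh n)}

/-- The one-dimensional hat function. -/
def hat (t : ℝ) : ℝ := max 0 (1 - |t|)

/-- The bilinear interpolant of the values of `φ` at the points of the `n × n` grid, written in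
the nodal basis; `gridInterp_eq_bilinear` is its form in a cell. -/
def gridInterp (n : ℕ) (φ : Plane → ℝ) (x : Plane) : ℝ :=
  ∑ i ∈ Finset.range n, ∑ j ∈ Finset.range n,
    φ (gridPoint n i j) * (hat (x 0 / mesh n - i) * hat (x 1 / mesh n - j))

/-- The encoding error: signed distance function minus its bilinear interpolant. -/
def encodingError (D : Set Plane) (n : ℕ) (x : Plane) : ℝ := sdf D x - gridInterp n (sdf D) x

/-- The partial derivative in the `k`-th coordinate direction. -/
def partialDeriv (k : Fin 2) (f : Plane → ℝ) (x : Plane) : ℝ :=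
  fderiv ℝ f x (EuclideanSpace.single k 1)

/-- The cells that are crossed by the medial axis. -/
def singularCells (D : Set Plane) (n : ℕ) : Set (Fin (n - 1) × Fin (n - 1)) :=
  {c | (cell n c.1 c.2 ∩ medialAxis D).Nonempty}

theorem sum_hat (n i : ℕ) (hi : i + 1 < n) (t : ℝ) (h0 : (i : ℝ) ≤ t) (h1 : t ≤ i + 1)
    (F : ℕ → ℝ) :
    ∑ k ∈ Finset.range n, F k * hat (t - k) = F i * (1 - (t - i)) + F (i + 1) * (t - i) := by
  have hz : ∀ k ∈ Finset.range n, k ∉ ({i, i + 1} : Finset ℕ) → F k * hat (t - k) = 0 := by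
    intro k _ hk
    simp only [Finset.mem_insert, Finset.mem_singleton, not_or] at hk
    have : hat (t - k) = 0 := by
      unfold hat
      apply max_eq_left
      rcases lt_or_gt_of_ne hk.1 with h | h
      · have : (k : ℝ) + 1 ≤ i := by exact_mod_cast h
        have := le_abs_self (t - k)
        linarith
      · have h2 : i + 2 ≤ k := by omega
        have : (i : ℝ) + 2 ≤ k := by exact_mod_cast h2
        have := neg_abs_le (t - k)
        linarith
    rw [this, mul_zero]
  have hs : ({i, i + 1} : Finset ℕ) ⊆ Finset.range n := by
    intro k hk
    simp only [Finset.mem_insert, Finset.mem_singleton] at hk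
    simp only [Finset.mem_range]
    omega
  rw [← Finset.sum_subset hs hz, Finset.sum_pair (by omega)]
  have e1 : hat (t - i) = 1 - (t - i) := by
    unfold hat
    rw [abs_of_nonneg (by linarith), max_eq_right (by linarith)]
  have e2 : hat (t - ((i + 1 : ℕ) : ℝ)) = t - i := by
    unfold hat
    push_cast
    rw [abs_of_nonpos (by linarith), max_eq_right (by linarith)]
    ring
  rw [e1, e2]

theorem gridInterp_eq_bilinear (n i j : ℕ) (hi : i + 1 < n) (hj : j + 1 < n) (φ : Plane → ℝ)
    (x : Plane) (hx : x ∈ cell n i j) :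
    gridInterp n φ x =
      φ (gridPoint n i j) * (1 - (x 0 / mesh n - i)) * (1 - (x 1 / mesh n - j)) +
      φ (gridPoint n (i + 1) j) * (x 0 / mesh n - i) * (1 - (x 1 / mesh n - j)) +
      φ (gridPoint n i (j + 1)) * (1 - (x 0 / mesh n - i)) * (x 1 / mesh n - j) +
      φ (gridPoint n (i + 1) (j + 1)) * (x 0 / mesh n - i) * (x 1 / mesh n - j) := by
  have hm : 0 < mesh n := by
    unfold mesh
    have : (2 : ℝ) ≤ n := by exact_mod_cast (by omega : 2 ≤ n)
    apply one_div_pos.mpr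
    linarith
  obtain ⟨⟨a0, a1⟩, ⟨b0, b1⟩⟩ := hx
  have key : gridInterp n φ x = ∑ k ∈ Finset.range n,
      (∑ l ∈ Finset.range n, φ (gridPoint n k l) * hat (x 1 / mesh n - l)) *
        hat (x 0 / mesh n - k) := by
    unfold gridInterp
    refine Finset.sum_congr rfl fun k _ => ?_
    rw [Finset.sum_mul]
    refine Finset.sum_congr rfl fun l _ => ?_
    ring
  rw [key, sum_hat n i hi _ ((le_div_iff₀ hm).2 a0) ((div_le_iff₀ hm).2 a1),
    sum_hat n j hj _ ((le_div_iff₀ hm).2 b0) ((div_le_iff₀ hm).2 b1),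
    sum_hat n j hj _ ((le_div_iff₀ hm).2 b0) ((div_le_iff₀ hm).2 b1)]
  ring

end SDFEncoding

end

/-! The signed distance $\phi$ is 1-Lipschitz, so on every cell the bilinear error is at most $h$;
this alone gives part 4. On a cell the bilinear error is a horizontal linear interpolation error
plus a convex combination of two vertical ones (`sub_gridInterp_eq`), so the other estimates reduce
to errors along segments.

Off the medial axis $\phi$ is $C^2$ (`contDiffAt_sdf`). There the foot point is unique, and off the
interface the empty ball can be enlarged while keeping its contact point (`exists_larger_ball`).
Comparing curvatures at the contact (`IsDefiningAt.hessian_ge`) shows that the centre is not a focal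
point, so the inverse function theorem makes the foot point $\pi$ a $C^1$ function. Then
$\nabla\phi=N\circ\pi$, with $N$ the unit normal field, is $C^1$ as well. Part 2 is then the usual
interpolation estimate.

For part 3, pick a point of $M$ in each singular cell. Either its component in $M\cap Q$ reaches
distance $h/2$ and so has length at least $h/2$ near the cell, or the component stays in a small
disc and accounts for boundedly many cells (`card_cells_le`). Part 5 adds up the two kinds of cells.

Part 1 is not read off from part 5: second derivatives may blow up near endpoints of the medial
axis, so $K$ need not be bounded in $n$. Instead, near each point of $Q$ one of $\pm\phi$ is
semiconvex with uniform constants, even across the medial axis (`uniformlySemiconvex_unitSquare`).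
For a semiconvex function the interpolation error is at most a second difference plus $O(h^2)$;
second differences telescope along a grid line, so the errors on a line sum to $O(h)$
(`exists_sum_abs_lineErr_le`). With one factor of $E^2$ bounded by $h$ and about $1/h$ lines, the
squared errors at corresponding points of all cells sum to $O(h)$; the cell area $h^2$ then gives
$O(h^3)$. -/

namespace SDFEncoding

open Set Metric Filter
open scoped RealInnerProductSpace

/-! ### The signed distance function: Lipschitz bound and sides of the interface. -/

theorem isBounded_unitSquare : Bornology.IsBounded unitSquare := by
  refine (isBounded_closedBall (x := (0 : Plane)) (r := 2)).subset fun x hx => ?_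
  rw [mem_closedBall, dist_zero_right, EuclideanSpace.norm_eq, Fin.sum_univ_two]
  have h0 := hx 0
  have h1 := hx 1
  refine Real.sqrt_le_iff.2 ⟨by norm_num, ?_⟩
  simp only [Real.norm_eq_abs, sq_abs]
  nlinarith [h0.1, h0.2, h1.1, h1.2]

theorem isClosed_unitSquare : IsClosed unitSquare := by
  have : unitSquare = ⋂ k, (fun x : Plane => x k) ⁻¹' Icc (0 : ℝ) 1 := by
    ext x; simp [unitSquare]
  rw [this]
  exact isClosed_iInter fun k => isClosed_Icc.preimage (by fun_prop)

theorem isCompact_unitSquare : IsCompact unitSquare :=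
  isCompact_of_isClosed_isBounded isClosed_unitSquare isBounded_unitSquare

theorem nonempty_frontier {D : Set Plane} (hD : D.Nonempty) (hQ : D ⊆ unitSquare) :
    (frontier D).Nonempty := by
  refine nonempty_frontier_iff.2 ⟨hD, fun h => ?_⟩
  have : (!₂[2, 2] : Plane) ∈ unitSquare := hQ (h ▸ mem_univ _)
  have := (this 0).2
  norm_num at this

theorem isCompact_frontier {D : Set Plane} (hc : IsClosed D) (hQ : D ⊆ unitSquare) :
    IsCompact (frontier D) :=
  isCompact_unitSquare.of_isClosed_subset isClosed_frontier (hc.frontier_subset.trans hQ)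

/-- Otherwise the interior and the exterior of `D` would separate `S`. -/
theorem inter_frontier_nonempty {X : Type*} [TopologicalSpace X] {S D : Set X}
    (hS : IsPreconnected S) (h1 : (S ∩ D).Nonempty) (h2 : (S ∩ Dᶜ).Nonempty) :
    (S ∩ frontier D).Nonempty := by
  by_contra hne
  rw [Set.not_nonempty_iff_eq_empty] at hne
  have hnf : ∀ x ∈ S, x ∉ frontier D := fun x hx hxf => (hne ▸ ⟨hx, hxf⟩ : x ∈ (∅ : Set X))
  obtain ⟨a, haS, haD⟩ := h1
  obtain ⟨b, hbS, hbD⟩ := h2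
  have hin : ∀ x ∈ S, x ∈ interior D ∨ x ∈ (closure D)ᶜ := by
    intro x hx
    by_contra! h
    exact hnf x hx ⟨not_not.1 h.2, h.1⟩
  obtain ⟨x, _, hx1, hx2⟩ := hS (interior D) (closure D)ᶜ isOpen_interior
    isClosed_closure.isOpen_compl hin
    ⟨a, haS, (hin a haS).resolve_right fun h => h (subset_closure haD)⟩
    ⟨b, hbS, (hin b hbS).resolve_left fun h => hbD (interior_subset h)⟩
  exact hx2 (subset_closure (interior_subset hx1))

theorem mem_iff_mem_of_disjoint_frontier {X : Type*} [TopologicalSpace X] {D S : Set X}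
    (hS : IsPreconnected S) (hd : Disjoint S (frontier D)) {x y : X} (hx : x ∈ S) (hy : y ∈ S) :
    x ∈ D ↔ y ∈ D := by
  have key : ∀ {a b : X}, a ∈ S → b ∈ S → a ∈ D → b ∈ D := by
    intro a b ha hb haD
    by_contra hbD
    have := inter_frontier_nonempty hS ⟨a, ha, haD⟩ ⟨b, hb, hbD⟩
    exact (disjoint_iff_inter_eq_empty.1 hd ▸ this).ne_empty rfl
  exact ⟨key hx hy, key hy hx⟩

/-- The segment from `x` to `y` crosses the interface, and the crossing point splits its length.
This is the Lipschitz bound for points on opposite sides. -/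
theorem infDist_add_infDist_le {D : Set Plane} {x y : Plane} (hx : x ∈ D) (hy : y ∉ D) :
    infDist x (frontier D) + infDist y (frontier D) ≤ dist x y := by
  obtain ⟨z, hz, hzf⟩ := inter_frontier_nonempty (D := D)
    (convex_segment x y).isPreconnected ⟨x, left_mem_segment ℝ x y, hx⟩ ⟨y, right_mem_segment ℝ x y, hy⟩
  have h1 := infDist_le_dist_of_mem hzf (x := x)
  have h2 := infDist_le_dist_of_mem hzf (x := y)
  have h3 := dist_add_dist_of_mem_segment hz
  rw [dist_comm z y] at h3
  linarith

theorem abs_sdf_sub_sdf_le (D : Set Plane) (x y : Plane) : |sdf D x - sdf D y| ≤ dist x y := by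
  have h1 := infDist_le_infDist_add_dist (s := frontier D) (x := x) (y := y)
  have h2 := infDist_le_infDist_add_dist (s := frontier D) (x := y) (y := x)
  rw [dist_comm y x] at h2
  have hnx := infDist_nonneg (x := x) (s := frontier D)
  have hny := infDist_nonneg (x := y) (s := frontier D)
  unfold sdf
  split_ifs with hx hy hy
  · rw [abs_le]; constructor <;> linarith
  · have := infDist_add_infDist_le hx hy
    rw [abs_le]; constructor <;> linarith
  · have := infDist_add_infDist_le hy hx
    rw [dist_comm] at this
    rw [abs_le]; constructor <;> linarith
  · rw [abs_le]; constructor <;> linarith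

theorem continuous_sdf (D : Set Plane) : Continuous (sdf D) :=
  (LipschitzWith.of_dist_le_mul (K := 1) fun x y => by
    simpa [Real.dist_eq] using abs_sdf_sub_sdf_le D x y).continuous

/-- The side of the interface: `-1` in `D`, `1` outside. -/
noncomputable def side (D : Set Plane) (x : Plane) : ℝ :=
  open Classical in if x ∈ D then -1 else 1

theorem sdf_eq_side_mul (D : Set Plane) (x : Plane) :
    sdf D x = side D x * infDist x (frontier D) := by
  unfold sdf side
  split_ifs <;> simp

theorem side_eq_or (D : Set Plane) (x : Plane) : side D x = 1 ∨ side D x = -1 := by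
  unfold side
  split_ifs <;> simp

theorem side_mul_self (D : Set Plane) (x : Plane) : side D x * side D x = 1 := by
  rcases side_eq_or D x with h | h <;> simp [h]

theorem disjoint_ball_infDist_self {X : Type*} [PseudoMetricSpace X] (s : Set X) (x : X) :
    Disjoint (ball x (infDist x s)) s := by
  rw [Set.disjoint_left]
  intro y hy hys
  have := infDist_le_dist_of_mem hys (x := x)
  rw [mem_ball, dist_comm] at hy
  linarith

theorem side_eq_of_mem_ball {D : Set Plane} {x y : Plane}
    (hy : y ∈ ball x (infDist x (frontier D))) : side D y = side D x := by
  have hx : x ∈ ball x (infDist x (frontier D)) :=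
    mem_ball_self (dist_nonneg.trans_lt hy)
  have := mem_iff_mem_of_disjoint_frontier (D := D) (convex_ball x _).isPreconnected
    (disjoint_ball_infDist_self _ _) hx hy
  unfold side
  by_cases h : x ∈ D
  · simp [h, this.1 h]
  · simp [h, mt this.2 h]

/-! ### Defining functions and the first-order condition at a foot point. -/

/-- A function is a defining function of `D` near `p`. -/
def IsDefiningAt (D : Set Plane) (f : Plane → ℝ) (p : Plane) : Prop :=
  ContDiffAt ℝ 2 f p ∧ gradient f p ≠ 0 ∧ ∀ᶠ x in 𝓝 p, (x ∈ D ↔ f x ≤ 0)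

theorem HasC2Boundary.exists_isDefiningAt {D : Set Plane} (hD : HasC2Boundary D) {p : Plane}
    (hp : p ∈ frontier D) : ∃ f, IsDefiningAt D f p := by
  obtain ⟨f, h1, h2, h3⟩ := hD p hp
  refine ⟨f, h1, fun h => h2 ?_, h3⟩
  unfold gradient at h
  simpa using h

theorem contDiffAt_gradient {f : Plane → ℝ} {p : Plane} (hf : ContDiffAt ℝ 2 f p) :
    ContDiffAt ℝ 1 (gradient f) p := by
  have : ContDiffAt ℝ 1 (fderiv ℝ f) p := hf.fderiv_right (by norm_num)
  exact (InnerProductSpace.toDual ℝ Plane).symm.contDiff.contDiffAt.comp p this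

/-- One function serves all interface points near `p`, so the conditions at foot points can be
applied to moving foot points with `f` fixed. -/
theorem IsDefiningAt.eventually {D : Set Plane} {f : Plane → ℝ} {p : Plane}
    (h : IsDefiningAt D f p) : ∀ᶠ q in 𝓝 p, IsDefiningAt D f q := by
  have h1 : ∀ᶠ q in 𝓝 p, ContDiffAt ℝ 2 f q := h.1.eventually (by simp)
  have h2 : ∀ᶠ q in 𝓝 p, gradient f q ≠ 0 :=
    (contDiffAt_gradient h.1).continuousAt.eventually_ne h.2.1
  filter_upwards [h1, h2, h.2.2.eventually_nhds] with q a b c using ⟨a, b, c⟩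

theorem IsDefiningAt.hasGradientAt {D : Set Plane} {f : Plane → ℝ} {p : Plane}
    (h : IsDefiningAt D f p) : HasGradientAt f (gradient f p) p :=
  (h.1.differentiableAt (by norm_num)).hasGradientAt

theorem IsDefiningAt.eq_zero {D : Set Plane} (hc : IsClosed D) {f : Plane → ℝ} {p : Plane}
    (h : IsDefiningAt D f p) (hp : p ∈ frontier D) : f p = 0 := by
  have hpD : p ∈ D := hc.frontier_subset hp
  have hle : f p ≤ 0 := h.2.2.self_of_nhds.1 hpD
  by_contra hne
  have hlt : f p < 0 := lt_of_le_of_ne hle hne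
  have h1 : ∀ᶠ x in 𝓝 p, f x < 0 := h.1.continuousAt.eventually_lt_const hlt
  have : p ∈ interior D := by
    rw [mem_interior_iff_mem_nhds]
    filter_upwards [h1, h.2.2] with x hx hx' using hx'.2 hx.le
  exact hp.2 this

/-- Near a nearest point, the defining function has a constant sign on the empty ball. -/
theorem IsDefiningAt.eventually_nonneg {D : Set Plane} {f : Plane → ℝ} {p y : Plane}
    (h : IsDefiningAt D f p) :
    ∀ᶠ x in 𝓝 p, dist x y < infDist y (frontier D) → 0 ≤ side D y * f x := by
  filter_upwards [h.2.2] with x hx hxy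
  rw [← side_eq_of_mem_ball (mem_ball.2 hxy)]
  unfold side
  split_ifs with hxD
  · have := hx.1 hxD
    linarith
  · have := mt hx.2 hxD
    push Not at this
    linarith

/-- Lagrange condition at a nearest point. -/
theorem IsDefiningAt.exists_sub_eq_smul {D : Set Plane} (hc : IsClosed D) {f : Plane → ℝ}
    {p y : Plane} (h : IsDefiningAt D f p) (hp : p ∈ frontier D)
    (hd : dist y p = infDist y (frontier D)) :
    y - p = (sdf D y / ‖gradient f p‖) • gradient f p := by
  have hf0 := h.eq_zero hc hp
  set n := gradient f p with hn
  have hnpos : 0 < ‖n‖ := norm_pos_iff.2 h.2.1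
  rcases eq_or_ne y p with rfl | hyp
  · have : sdf D y = 0 := by rw [sdf_eq_side_mul, ← hd]; simp
    simp [this]
  have hu : y - p ≠ 0 := sub_ne_zero.2 hyp
  set u := y - p with hudef
  have hupos : 0 < ‖u‖ := norm_pos_iff.2 hu
  have hdu : infDist y (frontier D) = ‖u‖ := by rw [← hd, dist_eq_norm]
  set s := side D y with hs
  -- Such a direction enters the empty ball around `y`, where `s * f` is nonnegative; since `f p =
  -- 0`, the one-sided derivative of `s * f` along `w` is nonnegative.
  have key : ∀ w : Plane, 0 < ⟪w, u⟫ → 0 ≤ s * ⟪n, w⟫ := by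
    intro w hw
    have hcurve : HasDerivAt (fun t : ℝ => p + t • w) w 0 := by
      simpa using ((hasDerivAt_id (0 : ℝ)).smul_const w).const_add p
    have hcont : Tendsto (fun t : ℝ => p + t • w) (𝓝[>] 0) (𝓝 p) := by
      have := hcurve.continuousAt.tendsto
      simp only [zero_smul, add_zero] at this
      exact this.mono_left nhdsWithin_le_nhds
    have hder : HasDerivAt (fun t : ℝ => s * f (p + t • w)) (s * ⟪n, w⟫) 0 := by
      have h1 : HasFDerivAt f (InnerProductSpace.toDual ℝ Plane n) (p + (0 : ℝ) • w) := by
        rw [zero_smul, add_zero]; exact h.hasGradientAt.hasFDerivAt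
      have := (h1.comp_hasDerivAt (0 : ℝ) hcurve).const_mul s
      simpa using this
    have hin : ∀ᶠ t : ℝ in 𝓝[>] 0, dist (p + t • w) y < infDist y (frontier D) := by
      have hsm : ∀ᶠ t : ℝ in 𝓝[>] 0, t * ‖w‖ ^ 2 < 2 * ⟪w, u⟫ := by
        have : Tendsto (fun t : ℝ => t * ‖w‖ ^ 2) (𝓝 0) (𝓝 0) := by
          have : Continuous fun t : ℝ => t * ‖w‖ ^ 2 := by fun_prop
          simpa using this.tendsto 0
        exact (this.mono_left nhdsWithin_le_nhds).eventually_lt_const (by linarith)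
      filter_upwards [hsm, self_mem_nhdsWithin] with t ht ht0
      have ht0 : 0 < t := ht0
      rw [hdu, dist_eq_norm]
      have e : p + t • w - y = t • w - u := by rw [hudef]; abel
      rw [e]
      refine lt_of_pow_lt_pow_left₀ 2 hupos.le ?_
      rw [norm_sub_sq_real, norm_smul, inner_smul_left, mul_pow, Real.norm_eq_abs, sq_abs]
      simp only [conj_trivial]
      nlinarith
    have hnn : ∀ᶠ t : ℝ in 𝓝[>] 0, 0 ≤ s * f (p + t • w) := by
      filter_upwards [hcont.eventually h.eventually_nonneg, hin] with t h1 h2 using h1 h2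
    have hslope := (hasDerivAt_iff_tendsto_slope.1 hder).mono_left
      (nhdsWithin_mono 0 (fun t (ht : 0 < t) => ht.ne') : 𝓝[>] (0:ℝ) ≤ 𝓝[≠] 0)
    refine ge_of_tendsto hslope ?_
    filter_upwards [hnn, self_mem_nhdsWithin] with t h1 h2
    have h2 : 0 < t := h2
    simp only [slope_def_field, zero_smul, add_zero, hf0, mul_zero, sub_zero]
    positivity
  -- Split the gradient into its component along `u` and an orthogonal rest `v`. A limit of `key`
  -- covers directions orthogonal to `u`; applied to both `v` and `-v` it forces `v = 0`.
  set a := ⟪n, u⟫ / ‖u‖ ^ 2 with ha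
  set v := n - a • u with hv
  have hvu : ⟪v, u⟫ = 0 := by
    rw [hv, inner_sub_left, inner_smul_left, real_inner_self_eq_norm_sq, ha]
    simp only [conj_trivial]
    field_simp
    ring
  have horth : ∀ w : Plane, ⟪w, u⟫ = 0 → 0 ≤ s * ⟪n, w⟫ := by
    intro w hw
    by_contra hneg
    push Not at hneg
    have h0 : ∀ ε : ℝ, 0 < ε → 0 ≤ s * ⟪n, w⟫ + ε * (s * ⟪n, u⟫) := by
      intro ε hε
      have := key (w + ε • u) (by
        rw [inner_add_left, hw, inner_smul_left, real_inner_self_eq_norm_sq]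
        simp only [conj_trivial]
        positivity)
      rw [inner_add_right, inner_smul_right] at this
      linarith
    -- This `ε` is so small that the perturbation recovers at most half of the supposed deficit.
    have := h0 (-(s * ⟪n, w⟫) / (2 * (1 + |s * ⟪n, u⟫|))) (by
      apply div_pos <;> [linarith; positivity])
    have hb : -(s * ⟪n, w⟫) / (2 * (1 + |s * ⟪n, u⟫|)) * (s * ⟪n, u⟫) ≤ -(s * ⟪n, w⟫) / 2 := by
      rw [div_mul_eq_mul_div, div_le_div_iff₀ (by positivity) (by norm_num)]
      have := le_abs_self (s * ⟪n, u⟫)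
      nlinarith
    linarith
  have hnv : ⟪n, v⟫ = 0 := by
    have h1 := horth v hvu
    have h2 := horth (-v) (by rw [inner_neg_left, hvu, neg_zero])
    rw [inner_neg_right] at h2
    rcases side_eq_or D y with h3 | h3 <;> rw [← hs] at h3 <;> rw [h3] at h1 h2 <;> linarith
  have hv0 : v = 0 := by
    have : ⟪v, v⟫ = 0 := by
      nth_rewrite 1 [hv]
      rw [inner_sub_left, hnv, inner_smul_left, real_inner_comm, hvu]
      simp
    exact inner_self_eq_zero.1 this
  have hna : n = a • u := sub_eq_zero.1 hv0
  have hsa : 0 ≤ s * a := by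
    have := key u (by rw [real_inner_self_eq_norm_sq]; positivity)
    rw [ha, ← mul_div_assoc]
    positivity
  have hnorm : ‖n‖ = s * a * ‖u‖ := by
    have : |a| = s * a := by
      have h4 : |s| = 1 := by rcases side_eq_or D y with h3 | h3 <;> rw [← hs] at h3 <;> simp [h3]
      rw [← abs_of_nonneg hsa, abs_mul, h4, one_mul]
    nth_rewrite 1 [hna]
    rw [norm_smul, Real.norm_eq_abs, this]
  have ha0 : a ≠ 0 := by
    rintro h0
    rw [h0] at hnorm
    simp at hnorm
    exact hnpos.ne' (by simpa using hnorm)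
  have hs0 : s ≠ 0 := by
    intro h0
    have := side_mul_self D y
    rw [← hs, h0] at this
    norm_num at this
  have hss : s * s = 1 := side_mul_self D y
  have hcoef : sdf D y / ‖n‖ * a = 1 := by
    rw [sdf_eq_side_mul, hdu, hnorm, ← hs]
    field_simp
  nth_rewrite 2 [hna]
  rw [smul_smul, hcoef, one_smul]

/-! ### Nearest points and enlargement of empty balls. -/

/-- `p` is a nearest point to `x` in `s`. -/
def IsNearest (s : Set Plane) (x p : Plane) : Prop := p ∈ s ∧ dist x p = infDist x s

theorem exists_isNearest {s : Set Plane} (hs : IsCompact s) (hne : s.Nonempty) (x : Plane) :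
    ∃ p, IsNearest s x p := by
  obtain ⟨p, hp, h⟩ := hs.exists_infDist_eq_dist hne x
  exact ⟨p, hp, h.symm⟩

/-- By compactness the part of `s` outside the interior of `U` is strictly farther from `x` than `s`
itself, and both distances are continuous in the centre. -/
theorem eventually_isNearest_mem {s : Set Plane} (hs : IsCompact s) {x p : Plane}
    (huniq : ∀ q, IsNearest s x q → q = p) {U : Set Plane} (hU : U ∈ 𝓝 p) :
    ∀ᶠ y in 𝓝 x, ∀ q, IsNearest s y q → q ∈ U := by
  set K := s \ interior U with hK
  have hKc : IsCompact K := hs.diff isOpen_interior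
  rcases K.eq_empty_or_nonempty with hemp | hne
  · refine Eventually.of_forall fun y q hq => interior_subset ?_
    by_contra hcon
    exact (hemp ▸ (⟨hq.1, hcon⟩ : q ∈ K) : q ∈ (∅ : Set Plane))
  have hlt : infDist x s < infDist x K := by
    obtain ⟨k, hk, hkd⟩ := hKc.exists_infDist_eq_dist hne x
    refine lt_of_le_of_ne (hkd ▸ infDist_le_dist_of_mem hk.1) fun heq => ?_
    have : k = p := huniq k ⟨hk.1, by rw [heq, hkd]⟩
    exact hk.2 (this ▸ mem_interior_iff_mem_nhds.2 hU)
  have h1 : ∀ᶠ y in 𝓝 x, infDist y s < infDist y K :=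
    (continuous_infDist_pt s).continuousAt.eventually_lt
      (continuous_infDist_pt K).continuousAt hlt
  filter_upwards [h1] with y hy q hq
  by_contra hcon
  have : infDist y K ≤ dist y q :=
    infDist_le_dist_of_mem ⟨hq.1, fun h => hcon (interior_subset h)⟩
  rw [hq.2] at this
  linarith

theorem isNearest_unique {D : Set Plane} {x p q : Plane} (hx : x ∉ medialAxis D)
    (hp : IsNearest (frontier D) x p) (hq : IsNearest (frontier D) x q) : q = p := by
  by_contra hne
  exact hx (subset_closure ⟨p, hp.1, q, hq.1, Ne.symm hne, hp.2, hq.2⟩)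

theorem isNearest_self {s : Set Plane} {x : Plane} (hx : x ∈ s) : IsNearest s x x :=
  ⟨hx, by rw [dist_self, infDist_zero_of_mem hx]⟩

theorem eq_of_isNearest_self {s : Set Plane} {x q : Plane} (hx : x ∈ s) (hq : IsNearest s x q) :
    q = x := by
  have := hq.2
  rw [infDist_zero_of_mem hx] at this
  exact (dist_eq_zero.1 this).symm

/-- The distance grows at unit rate in the direction away from a unique nearest point. -/
theorem eventually_infDist_growth {s : Set Plane} (hs : IsCompact s) {y p : Plane}
    (hp : IsNearest s y p) (huniq : ∀ q, IsNearest s y q → q = p) (hy : y ≠ p) {c : ℝ}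
    (hc : c < 1) :
    ∀ᶠ t : ℝ in 𝓝[>] 0, infDist y s + c * t ≤ infDist (y + (t / ‖y - p‖) • (y - p)) s := by
  set u := y - p with hu
  have hupos : 0 < ‖u‖ := norm_pos_iff.2 (sub_ne_zero.2 hy)
  have hd : infDist y s = ‖u‖ := by rw [← hp.2, dist_eq_norm]
  -- The factor `(1 + c) / 2` lies strictly between `c` and `1`: moving by `t` raises the squared
  -- distance by at least `(1 + c) * t * ‖u‖`, which for small `t` exceeds the required `2 * c * t *
  -- ‖u‖ + c ^ 2 * t ^ 2`.
  have hU : ∀ᶠ q in 𝓝 p, (1 + c) / 2 * ‖u‖ ^ 2 < ⟪u, y - q⟫ := by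
    have : ContinuousAt (fun q => ⟪u, y - q⟫) p := by fun_prop
    refine this.eventually_const_lt ?_
    change _ < ⟪u, u⟫
    rw [real_inner_self_eq_norm_sq]
    nlinarith [sq_pos_of_pos hupos]
  have hlim : Tendsto (fun t : ℝ => y + (t / ‖u‖) • u) (𝓝[>] 0) (𝓝 y) := by
    have : Continuous fun t : ℝ => y + (t / ‖u‖) • u := by fun_prop
    have := this.tendsto 0
    simp only [zero_div, zero_smul, add_zero] at this
    exact this.mono_left nhdsWithin_le_nhds
  have hsmall : ∀ᶠ t : ℝ in 𝓝[>] 0, c ^ 2 * t < (1 - c) * ‖u‖ := by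
    have : Continuous fun t : ℝ => c ^ 2 * t := by fun_prop
    have := this.tendsto 0
    rw [mul_zero] at this
    exact (this.mono_left nhdsWithin_le_nhds).eventually_lt_const
      (mul_pos (by linarith) hupos)
  filter_upwards [hlim.eventually (eventually_isNearest_mem hs huniq hU), hsmall,
    self_mem_nhdsWithin] with t h1 h2 h3
  have h3 : 0 < t := h3
  obtain ⟨q, hq⟩ := exists_isNearest hs ⟨p, hp.1⟩ (y + (t / ‖u‖) • u)
  have hqU : (1 + c) / 2 * ‖u‖ ^ 2 < ⟪u, y - q⟫ := h1 q hq
  have hyq : ‖u‖ ≤ ‖y - q‖ := by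
    rw [← hd, ← dist_eq_norm]; exact infDist_le_dist_of_mem hq.1
  rw [← hq.2, hd, dist_eq_norm]
  refine le_of_sq_le_sq ?_ (norm_nonneg _)
  have e : y + (t / ‖u‖) • u - q = (y - q) + (t / ‖u‖) • u := by abel
  rw [e, norm_add_sq_real, inner_smul_right, norm_smul, real_inner_comm, Real.norm_eq_abs,
    mul_pow, sq_abs, div_pow, div_mul_cancel₀ _ (by positivity)]
  have h5 : t / ‖u‖ * ((1 + c) / 2 * ‖u‖ ^ 2) ≤ t / ‖u‖ * ⟪u, y - q⟫ := by gcongr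
  have h6 : t / ‖u‖ * ((1 + c) / 2 * ‖u‖ ^ 2) = t * (1 + c) / 2 * ‖u‖ := by field_simp
  rw [h6] at h5
  nlinarith [mul_pos h3 hupos, sq_nonneg t]

/-- Away from the medial axis the empty ball can be enlarged without losing the nearest point. -/
theorem exists_larger_ball {D : Set Plane} (hG : IsCompact (frontier D)) {x p : Plane}
    (hx : x ∉ medialAxis D) (hp : IsNearest (frontier D) x p) (hxp : x ∉ frontier D) :
    ∃ z, side D z = side D x ∧ IsNearest (frontier D) z p ∧ dist x p < dist z p := by
  have hopen : IsOpen ((medialAxis D)ᶜ ∩ (frontier D)ᶜ) :=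
    isClosed_closure.isOpen_compl.inter isClosed_frontier.isOpen_compl
  obtain ⟨ε, hε, hball⟩ := nhds_basis_closedBall.mem_iff.1 (hopen.mem_nhds ⟨hx, hxp⟩)
  have hcomp : IsCompact (closedBall x ε) := isCompact_closedBall x ε
  have hne : (closedBall x ε).Nonempty := ⟨x, mem_closedBall_self hε.le⟩
  obtain ⟨z, hz, hzmax⟩ := hcomp.exists_isMaxOn hne
    (continuous_infDist_pt (frontier D)).continuousOn
  -- Maximise the distance minus the penalty `c * dist w x`. An interior maximiser is impossible,
  -- since the distance can still grow there at rate `(1 + c) / 2 > c`; hence the maximiser lies on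
  -- the sphere of radius `ε`, where the penalty is `c * ε`.
  have hgrow : ∀ c : ℝ, 0 < c → c < 1 → infDist x (frontier D) + c * ε ≤ infDist z (frontier D) := by
    intro c hc0 hc1
    have hcont : Continuous fun w => infDist w (frontier D) - c * dist w x := by
      have := continuous_infDist_pt (frontier D)
      fun_prop
    obtain ⟨w, hw, hwmax⟩ := hcomp.exists_isMaxOn hne hcont.continuousOn
    have hwx : infDist x (frontier D) ≤ infDist w (frontier D) - c * dist w x := by
      simpa using hwmax (mem_closedBall_self hε.le)
    rcases (mem_closedBall.1 hw).lt_or_eq with hlt | heq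
    · exfalso
      obtain ⟨q, hq⟩ := exists_isNearest hG ⟨p, hp.1⟩ w
      have hwq : w ≠ q := fun h => (hball hw).2 (h ▸ hq.1)
      have hupos : 0 < ‖w - q‖ := norm_pos_iff.2 (sub_ne_zero.2 hwq)
      have h1 := eventually_infDist_growth hG hq
        (fun q' hq' => isNearest_unique (hball hw).1 hq hq') hwq (c := (1 + c) / 2) (by linarith)
      have hlim : Tendsto (fun t : ℝ => w + (t / ‖w - q‖) • (w - q)) (𝓝[>] 0) (𝓝 w) := by
        have : Continuous fun t : ℝ => w + (t / ‖w - q‖) • (w - q) := by fun_prop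
        have := this.tendsto 0
        simp only [zero_div, zero_smul, add_zero] at this
        exact this.mono_left nhdsWithin_le_nhds
      have h2 := hlim.eventually (isOpen_ball.mem_nhds (mem_ball.2 hlt))
      obtain ⟨t, ht1, ht2, ht3⟩ := (h1.and (h2.and self_mem_nhdsWithin)).exists
      have ht3 : 0 < t := ht3
      have h4 := hwmax (ball_subset_closedBall ht2)
      simp only [Set.mem_ofPred_eq] at h4
      have h5 : dist (w + (t / ‖w - q‖) • (w - q)) x ≤ dist w x + t := by
        refine (dist_triangle _ w _).trans ?_
        rw [dist_eq_norm (w + _) w, add_sub_cancel_left, norm_smul, Real.norm_eq_abs,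
          abs_of_pos (by positivity), div_mul_cancel₀ _ hupos.ne']
        linarith
      nlinarith
    · have := hzmax hw
      simp only [Set.mem_ofPred_eq] at this
      rw [heq] at hwx
      linarith
  -- Let `c` tend to `1`. Together with the triangle inequality through `x` this makes `p` a nearest
  -- point of `z` too.
  have hge : infDist x (frontier D) + ε ≤ infDist z (frontier D) := by
    refine le_of_forall_pos_lt_add fun δ hδ => ?_
    have hmin : 0 < min (1 / 2) (δ / (2 * ε)) := by positivity
    have := hgrow (1 - min (1 / 2) (δ / (2 * ε)))
      (by linarith [min_le_left (1 / 2) (δ / (2 * ε))]) (by linarith)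
    have h2 : min (1 / 2) (δ / (2 * ε)) * ε ≤ δ / 2 := by
      calc min (1 / 2) (δ / (2 * ε)) * ε ≤ δ / (2 * ε) * ε := by
            gcongr; exact min_le_right _ _
        _ = δ / 2 := by field_simp
    nlinarith
  have hzp : dist z p ≤ ε + dist x p :=
    (dist_triangle z x p).trans (by gcongr; exact mem_closedBall.1 hz)
  have hle := infDist_le_dist_of_mem hp.1 (x := z)
  have hpx := hp.2
  refine ⟨z, ?_, ⟨hp.1, by linarith⟩, by linarith⟩
  have hmem := mem_iff_mem_of_disjoint_frontier (D := D) (convex_closedBall x ε).isPreconnected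
    (Set.disjoint_left.2 fun w hw => (hball hw).2) hz (mem_closedBall_self hε.le)
  unfold side
  by_cases h : z ∈ D
  · simp [h, hmem.1 h]
  · simp [h, mt hmem.2 h]

/-! ### Second-order condition at a foot point. -/

theorem second_deriv_nonneg {h h' : ℝ → ℝ} {B : ℝ} (hd : ∀ᶠ t in 𝓝 0, HasDerivAt h (h' t) t)
    (h0 : h' 0 = 0) (hz : h 0 = 0) (hB : HasDerivAt h' B 0) (hnn : ∀ᶠ t in 𝓝 0, 0 ≤ h t) :
    0 ≤ B := by
  by_contra hneg
  push Not at hneg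
  -- If `B < 0`, this function has a critical point at `0` with second derivative `-B / 2 > 0`,
  -- hence a local minimum of value `0`. But it is at most `B / 4 * t ^ 2`, which is negative for `t
  -- ≠ 0`.
  have hk : ∀ᶠ t in 𝓝 0, HasDerivAt (fun t => -h t + B / 4 * t ^ 2) (-h' t + B / 2 * t) t := by
    filter_upwards [hd] with t ht
    refine (ht.neg.add ((hasDerivAt_pow 2 t).const_mul (B / 4))).congr_deriv ?_
    norm_num
    ring
  have hk' : HasDerivAt (fun t => -h' t + B / 2 * t) (-B / 2) 0 := by
    refine (hB.neg.add ((hasDerivAt_id' (0 : ℝ)).const_mul (B / 2))).congr_deriv ?_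
    ring
  have hdk : deriv (fun t => -h t + B / 4 * t ^ 2) =ᶠ[𝓝 0] fun t => -h' t + B / 2 * t := by
    filter_upwards [hk] with t ht using ht.deriv
  have hmin : IsLocalMin (fun t => -h t + B / 4 * t ^ 2) 0 := by
    refine isLocalMin_of_deriv_deriv_pos ?_ ?_ hk.self_of_nhds.continuousAt
    · rw [hdk.deriv_eq, hk'.deriv]; linarith
    · rw [hdk.eq_of_nhds, h0]; ring
  have hev : ∀ᶠ t : ℝ in 𝓝 0, t = 0 := by
    filter_upwards [hmin, hnn] with t h1 h2
    simp only [hz] at h1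
    by_contra ht
    have : 0 < t ^ 2 := by positivity
    nlinarith
  obtain ⟨ε, hε, hb⟩ := Metric.eventually_nhds_iff.1 hev
  have := hb (y := ε / 2) (by rw [Real.dist_eq, sub_zero, abs_of_pos (by linarith)]; linarith)
  linarith

/-- Curvature bound at a point where an empty ball touches the interface. -/
theorem IsDefiningAt.hessian_ge {D : Set Plane} (hc : IsClosed D) {f : Plane → ℝ}
    {p z : Plane} (h : IsDefiningAt D f p) (hp : IsNearest (frontier D) z p) (hz : 0 < dist z p)
    {v : Plane} (hv : ⟪gradient f p, v⟫ = 0) :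
    -(‖v‖ ^ 2 * ‖gradient f p‖ / dist z p) ≤
      side D z * ⟪fderiv ℝ (gradient f) p v, v⟫ := by
  have hf0 := h.eq_zero hc hp.1
  have hlag := h.exists_sub_eq_smul hc hp.1 hp.2
  set n := gradient f p with hn
  set r := dist z p with hr
  set s := side D z with hs
  have hss : s * s = 1 := side_mul_self D z
  have hnpos : 0 < ‖n‖ := norm_pos_iff.2 h.2.1
  set e : Plane := (s / ‖n‖) • n with he
  have hze : z - p = r • e := by
    rw [hlag, sdf_eq_side_mul, ← hp.2, he, smul_smul]
    congr 1
    ring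
  have hee : ‖e‖ ^ 2 = 1 := by
    rw [he, norm_smul, mul_pow, Real.norm_eq_abs, sq_abs, div_pow, sq s, hss]
    field_simp
  have hev : ⟪v, e⟫ = 0 := by rw [he, inner_smul_right, real_inner_comm, hv, mul_zero]
  have hne : s * ⟪n, e⟫ = ‖n‖ := by
    rw [he, inner_smul_right, real_inner_self_eq_norm_sq]
    field_simp
    linear_combination hss
  -- The parabola `p + t v + a t² e`, with `e` the unit vector from `p` towards `z`, runs inside the
  -- empty ball for small `t ≠ 0` exactly because `‖v‖ ^ 2 < 2 * a * r`. There `s * f ≥ 0`, so its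
  -- second derivative along the parabola is nonnegative at `0`.
  have key : ∀ a : ℝ, ‖v‖ ^ 2 < 2 * a * r →
      0 ≤ s * ⟪fderiv ℝ (gradient f) p v, v⟫ + 2 * a * ‖n‖ := by
    intro a ha
    set c : ℝ → Plane := fun t => p + t • v + (a * t ^ 2) • e with hcdef
    set c' : ℝ → Plane := fun t => v + (2 * a * t) • e with hc'def
    have hc0 : c 0 = p := by simp [hcdef]
    have hc'0 : c' 0 = v := by simp [hc'def]
    have hcd : ∀ t, HasDerivAt c (c' t) t := by
      intro t
      have h1 := ((hasDerivAt_id t).smul_const v).const_add p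
      have h2 := (((hasDerivAt_pow 2 t).const_mul a).smul_const e)
      refine (h1.add h2).congr_deriv ?_
      simp only [hc'def, one_smul]
      congr 2
      norm_num
      ring
    have hc'd : HasDerivAt c' ((2 * a) • e) 0 := by
      have h2 := (((hasDerivAt_id' (0 : ℝ)).const_mul (2 * a)).smul_const e).const_add v
      exact h2.congr_deriv (by simp)
    have hctend : Tendsto c (𝓝 0) (𝓝 p) := by
      have := (hcd 0).continuousAt.tendsto
      rwa [hc0] at this
    refine second_deriv_nonneg (h := fun t => s * f (c t))
      (h' := fun t => s * ⟪gradient f (c t), c' t⟫) ?_ ?_ ?_ ?_ ?_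
    · filter_upwards [hctend.eventually h.eventually] with t ht
      have := (ht.hasGradientAt.hasFDerivAt.comp_hasDerivAt t (hcd t)).const_mul s
      rw [← InnerProductSpace.toDual_apply_apply]
      exact this
    · simp [hc0, hc'0, ← hn, hv]
    · simp [hc0, hf0]
    · have hg : HasFDerivAt (gradient f) (fderiv ℝ (gradient f) p) (c 0) := by
        rw [hc0]
        exact ((contDiffAt_gradient h.1).differentiableAt (by norm_num)).hasFDerivAt
      have h1 := (hg.comp_hasDerivAt (0 : ℝ) (hcd 0))
      have h2 := (h1.inner ℝ hc'd).const_mul s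
      refine h2.congr_deriv ?_
      simp only [Function.comp, hc0, hc'0, ← hn, inner_smul_right]
      linear_combination 2 * a * hne
    · have hin : ∀ᶠ t : ℝ in 𝓝 0, t = 0 ∨ dist (c t) z < infDist z (frontier D) := by
        have hsm : ∀ᶠ t : ℝ in 𝓝 0, ‖v‖ ^ 2 + a ^ 2 * t ^ 2 < 2 * a * r := by
          have : ContinuousAt (fun t : ℝ => ‖v‖ ^ 2 + a ^ 2 * t ^ 2) 0 := by fun_prop
          exact this.eventually_lt_const (by simpa using ha)
        filter_upwards [hsm] with t ht
        by_cases ht0 : t = 0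
        · exact Or.inl ht0
        right
        have htp : 0 < t ^ 2 := by positivity
        rw [← hp.2, ← hr, dist_eq_norm]
        have e1 : c t - z = t • v + (a * t ^ 2 - r) • e := by
          have : z = p + r • e := by rw [← hze]; abel
          rw [this]
          change p + t • v + (a * t ^ 2) • e - (p + r • e) = _
          module
        rw [e1]
        refine lt_of_pow_lt_pow_left₀ 2 hz.le ?_
        rw [norm_add_sq_real, inner_smul_left, inner_smul_right, hev, norm_smul, norm_smul,
          mul_pow, mul_pow, hee, Real.norm_eq_abs, Real.norm_eq_abs, sq_abs, sq_abs]
        simp only [mul_zero, add_zero, mul_one]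
        nlinarith
      filter_upwards [hctend.eventually h.eventually_nonneg, hin] with t h1 h2
      rcases h2 with rfl | h2
      · simp [hc0, hf0]
      · exact h1 h2
  -- Let `a` decrease to the critical value `‖v‖ ^ 2 / (2 * r)`, the curvature of the ball.
  have hlim : ∀ δ : ℝ, 0 < δ →
      0 ≤ s * ⟪fderiv ℝ (gradient f) p v, v⟫ + ‖v‖ ^ 2 * ‖n‖ / r + δ := by
    intro δ hδ
    have := key (‖v‖ ^ 2 / (2 * r) + δ / (2 * ‖n‖)) (by
      have : 2 * (‖v‖ ^ 2 / (2 * r) + δ / (2 * ‖n‖)) * r = ‖v‖ ^ 2 + δ / ‖n‖ * r := by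
        field_simp
      rw [this]
      have : 0 < δ / ‖n‖ * r := by positivity
      linarith)
    have e2 : 2 * (‖v‖ ^ 2 / (2 * r) + δ / (2 * ‖n‖)) * ‖n‖ = ‖v‖ ^ 2 * ‖n‖ / r + δ := by
      field_simp
    rw [e2] at this
    linarith
  by_contra hcon
  push Not at hcon
  have := hlim (-(s * ⟪fderiv ℝ (gradient f) p v, v⟫ + ‖v‖ ^ 2 * ‖n‖ / r) / 2) (by linarith)
  linarith

/-! ### Regularity of the signed distance off the medial axis. -/

/-- The map whose inverse gives the foot point and the Lagrange multiplier. -/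
noncomputable def normalMap (f : Plane → ℝ) (z : Plane × ℝ) : Plane × ℝ :=
  (z.1 + z.2 • gradient f z.1, f z.1)

/-- Local inversion of the normal map under the nondegeneracy condition on the curvature. -/
theorem exists_localInverse_normalMap {f : Plane → ℝ} {p : Plane} {l : ℝ}
    (hf : ContDiffAt ℝ 2 f p) (hn : gradient f p ≠ 0)
    (hpos : ∀ v : Plane, v ≠ 0 → ⟪gradient f p, v⟫ = 0 →
      0 < ‖v‖ ^ 2 + l * ⟪fderiv ℝ (gradient f) p v, v⟫) :
    ∃ g : Plane × ℝ → Plane × ℝ, ContDiffAt ℝ 1 g (normalMap f (p, l)) ∧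
      ∀ᶠ z in 𝓝 (p, l), g (normalMap f z) = z := by
  have hgrad := contDiffAt_gradient hf
  have hG : ContDiffAt ℝ 1 (normalMap f) (p, l) := by
    have h1 : ContDiffAt ℝ 1 (fun z : Plane × ℝ => gradient f z.1) (p, l) :=
      ContDiffAt.comp (p, l) (f := Prod.fst) hgrad contDiffAt_fst
    have h2 : ContDiffAt ℝ 1 (fun z : Plane × ℝ => f z.1) (p, l) :=
      ContDiffAt.comp (p, l) (f := Prod.fst) (hf.of_le (by norm_num)) contDiffAt_fst
    exact (contDiffAt_fst.add (contDiffAt_snd.smul h1)).prodMk h2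
  set H := fderiv ℝ (gradient f) p with hH
  set n := gradient f p with hndef
  set A : Plane × ℝ →L[ℝ] Plane × ℝ := fderiv ℝ (normalMap f) (p, l) with hA
  have hAval : ∀ w : Plane × ℝ, A w = (w.1 + (l • H w.1 + w.2 • n), ⟪n, w.1⟫) := by
    have h1 : HasFDerivAt (fun z : Plane × ℝ => gradient f z.1)
        (H.comp (ContinuousLinearMap.fst ℝ Plane ℝ)) (p, l) :=
      HasFDerivAt.comp (p, l) (f := Prod.fst)
        ((hgrad.differentiableAt (by norm_num)).hasFDerivAt) hasFDerivAt_fst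
    have h2 : HasFDerivAt (fun z : Plane × ℝ => f z.1)
        ((InnerProductSpace.toDual ℝ Plane n).comp (ContinuousLinearMap.fst ℝ Plane ℝ)) (p, l) :=
      HasFDerivAt.comp (p, l) (f := Prod.fst)
        ((hf.differentiableAt (by norm_num)).hasGradientAt.hasFDerivAt) hasFDerivAt_fst
    have h3 := (hasFDerivAt_fst.add ((hasFDerivAt_snd (p := (p, l))).smul h1)).prodMk h2
    have h4 : HasFDerivAt (normalMap f) _ (p, l) := h3
    intro w
    rw [hA, h4.fderiv]
    simp [← hndef]
  -- For a kernel vector `(v, m)` the second component gives `v ⟂ n`. Pairing the first with `v`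
  -- removes `m` and contradicts `hpos` unless `v = 0`; then `m = 0` since `n ≠ 0`.
  have hinj : Function.Injective A := by
    rw [injective_iff_map_eq_zero]
    rintro ⟨v, m⟩ hw
    rw [hAval] at hw
    simp only [Prod.mk_eq_zero] at hw
    obtain ⟨hw1, hw2⟩ := hw
    have hv : v = 0 := by
      by_contra hv
      have := hpos v hv hw2
      have h5 : ⟪v + (l • H v + m • n), v⟫ = 0 := by rw [hw1, inner_zero_left]
      rw [inner_add_left, inner_add_left, inner_smul_left, inner_smul_left, hw2,
        real_inner_self_eq_norm_sq] at h5
      simp only [conj_trivial, mul_zero, add_zero] at h5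
      linarith
    subst hv
    simp only [map_zero, smul_zero, zero_add, smul_eq_zero] at hw1
    rw [hw1.resolve_right hn]
    rfl
  let e : (Plane × ℝ) ≃L[ℝ] (Plane × ℝ) :=
    (LinearEquiv.ofInjectiveEndo (A : Plane × ℝ →ₗ[ℝ] Plane × ℝ) hinj).toContinuousLinearEquiv
  have he : (e : Plane × ℝ →L[ℝ] Plane × ℝ) = A := by
    ext w <;> rfl
  have hd : HasFDerivAt (normalMap f) (e : Plane × ℝ →L[ℝ] Plane × ℝ) (p, l) := by
    rw [he]; exact (hG.differentiableAt (by norm_num)).hasFDerivAt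
  refine ⟨hG.localInverse hd (by norm_num), hG.to_localInverse hd (by norm_num), ?_⟩
  exact (hG.hasStrictFDerivAt' hd (by norm_num)).eventually_left_inverse

/-- The signed distance function is `C²` where the foot point is unique and not a focal point. -/
theorem contDiffAt_sdf_of_unique {D : Set Plane} (hc : IsClosed D) (hG : IsCompact (frontier D))
    {f : Plane → ℝ} {x p : Plane} (hf : IsDefiningAt D f p) (hp : IsNearest (frontier D) x p)
    (huniq : ∀ q, IsNearest (frontier D) x q → q = p)
    (hpos : ∀ v : Plane, v ≠ 0 → ⟪gradient f p, v⟫ = 0 →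
      0 < ‖v‖ ^ 2 + sdf D x / ‖gradient f p‖ * ⟪fderiv ℝ (gradient f) p v, v⟫) :
    ContDiffAt ℝ 2 (sdf D) x := by
  set l : ℝ := sdf D x / ‖gradient f p‖ with hl
  obtain ⟨g, hg, hginv⟩ := exists_localInverse_normalMap hf.1 hf.2.1 hpos
  have hx0 : normalMap f (p, l) = (x, 0) := by
    have := hf.exists_sub_eq_smul hc hp.1 hp.2
    rw [normalMap, hf.eq_zero hc hp.1, ← this]
    simp
  rw [hx0] at hg
  set π : Plane → Plane := fun y => (g (y, 0)).1 with hπ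
  have hπC : ContDiffAt ℝ 1 π x := by
    have h1 : ContDiffAt ℝ 1 (fun y : Plane => g (y, 0)) x :=
      ContDiffAt.comp x (f := fun y : Plane => (y, (0 : ℝ))) hg
        (contDiffAt_id.prodMk contDiffAt_const)
    exact contDiffAt_fst.comp x h1
  have hπx : π x = p := by
    have := hginv.self_of_nhds
    rw [hx0] at this
    simp [hπ, this]
  set N : Plane → Plane := fun q => ‖gradient f q‖⁻¹ • gradient f q with hN
  have hNC : ∀ {q}, IsDefiningAt D f q → ContDiffAt ℝ 1 N q := fun {q} hq =>
    (((contDiffAt_gradient hq.1).norm ℝ hq.2.1).inv (norm_ne_zero_iff.2 hq.2.1)).smul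
      (contDiffAt_gradient hq.1)
  -- all nearest points of nearby points are given by `π`
  have hev : ∀ᶠ y in 𝓝 x, f (π y) = 0 ∧ IsDefiningAt D f (π y) ∧
      y - π y = sdf D y • N (π y) := by
    have hcont : ContinuousAt (fun z : Plane × Plane => (z.1, sdf D z.2 / ‖gradient f z.1‖))
        (p, x) := by
      have h1 : ContinuousAt (fun z : Plane × Plane => gradient f z.1) (p, x) :=
        ContinuousAt.comp (x := (p, x)) (f := (Prod.fst : Plane × Plane → Plane))
          (g := gradient f) (contDiffAt_gradient hf.1).continuousAt continuousAt_fst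
      have h2 := (continuous_sdf D)
      refine continuousAt_fst.prodMk (ContinuousAt.div (by fun_prop) h1.norm ?_)
      exact norm_ne_zero_iff.2 hf.2.1
    have h1 := hcont.tendsto.eventually hginv
    have h2 : ∀ᶠ z : Plane × Plane in 𝓝 (p, x), IsDefiningAt D f z.1 :=
      continuousAt_fst.eventually hf.eventually
    have h3 := h1.and h2
    rw [nhds_prod_eq] at h3
    obtain ⟨P, hP, Q, hQ, hPQ⟩ := eventually_prod_iff.1 h3
    filter_upwards [eventually_isNearest_mem hG huniq hP, hQ] with y hy1 hy2
    obtain ⟨q, hq⟩ := exists_isNearest hG ⟨p, hp.1⟩ y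
    obtain ⟨h4, h5⟩ := hPQ (hy1 q hq) hy2
    simp only at h4 h5
    have hlag := h5.exists_sub_eq_smul hc hq.1 hq.2
    have hqπ : π y = q := by
      have : normalMap f (q, sdf D y / ‖gradient f q‖) = (y, 0) := by
        rw [normalMap, h5.eq_zero hc hq.1, ← hlag]
        simp
      rw [this] at h4
      simp [hπ, h4]
    rw [hqπ]
    refine ⟨h5.eq_zero hc hq.1, h5, ?_⟩
    rw [hlag, hN, smul_smul, div_eq_mul_inv]
  have hπD : ∀ᶠ y in 𝓝 x, DifferentiableAt ℝ π y := by
    filter_upwards [hπC.eventually (by simp)] with y hy using hy.differentiableAt (by norm_num)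
  -- Differentiate `sdf D y = ⟪y - π y, N (π y)⟫`. The derivative of `π` is orthogonal to `N`
  -- because `f ∘ π = 0`, and that of `N ∘ π` is orthogonal to `y - π y`, a multiple of the unit
  -- vector `N (π y)`. Only `N (π y)` survives; it is $C^1$ in `y`, which gains the second
  -- derivative.
  have hder : ∀ᶠ y in 𝓝 x, HasFDerivAt (sdf D) (InnerProductSpace.toDual ℝ Plane (N (π y))) y := by
    filter_upwards [hev.eventually_nhds, hπD] with y hy hyD
    obtain ⟨hy0, hydef, hylag⟩ := hy.self_of_nhds
    have hN1 : ∀ {q}, IsDefiningAt D f q → ⟪N q, N q⟫ = 1 := by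
      intro q hq
      have := norm_ne_zero_iff.2 hq.2.1
      rw [real_inner_self_eq_norm_sq, hN]
      simp only [norm_smul, norm_inv, norm_norm]
      rw [inv_mul_cancel₀ this, one_pow]
    have hW : HasFDerivAt (fun z => N (π z)) ((fderiv ℝ N (π y)).comp (fderiv ℝ π y)) y :=
      HasFDerivAt.comp y ((hNC hydef).differentiableAt (by norm_num)).hasFDerivAt hyD.hasFDerivAt
    set W' := (fderiv ℝ N (π y)).comp (fderiv ℝ π y)
    have hWW : ∀ v, ⟪N (π y), W' v⟫ = 0 := by
      intro v
      have h1 := (hW.inner ℝ hW)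
      have h2 : HasFDerivAt (fun z => ⟪N (π z), N (π z)⟫) (0 : Plane →L[ℝ] ℝ) y := by
        refine (hasFDerivAt_const (1 : ℝ) y).congr_of_eventuallyEq ?_
        filter_upwards [hy] with z hz using hN1 hz.2.1
      have h3 := congrArg (fun L : Plane →L[ℝ] ℝ => L v) (h1.unique h2)
      simpa [fderivInnerCLM_apply, real_inner_comm] using h3
    have hfπ : ∀ v, ⟪N (π y), fderiv ℝ π y v⟫ = 0 := by
      intro v
      have h1 := hydef.hasGradientAt.hasFDerivAt.comp y hyD.hasFDerivAt
      have h2 : HasFDerivAt (f ∘ π) (0 : Plane →L[ℝ] ℝ) y := by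
        refine (hasFDerivAt_const (0 : ℝ) y).congr_of_eventuallyEq ?_
        filter_upwards [hy] with z hz using hz.1
      have h3 := congrArg (fun L : Plane →L[ℝ] ℝ => L v) (h1.unique h2)
      rw [hN, inner_smul_left]
      simp only [ContinuousLinearMap.comp_apply, zero_apply] at h3
      rw [InnerProductSpace.toDual_apply_apply] at h3
      rw [h3, mul_zero]
    have hmain : HasFDerivAt (fun z => ⟪z - π z, N (π z)⟫)
        (InnerProductSpace.toDual ℝ Plane (N (π y))) y := by
      refine (((hasFDerivAt_id y).sub hyD.hasFDerivAt).inner ℝ hW).congr_fderiv ?_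
      ext1 v
      have h5 : ⟪y - π y, W' v⟫ = 0 := by
        rw [hylag, inner_smul_left, hWW, mul_zero]
      have h6 := hfπ v
      rw [real_inner_comm] at h6
      simp only [ContinuousLinearMap.comp_apply, ContinuousLinearMap.prod_apply,
        fderivInnerCLM_apply, sub_apply, ContinuousLinearMap.id_apply,
        InnerProductSpace.toDual_apply_apply]
      change ⟪y - π y, W' v⟫ + _ = _
      rw [h5, inner_sub_left, h6, real_inner_comm]
      ring
    refine hmain.congr_of_eventuallyEq ?_
    filter_upwards [hy] with z hz
    rw [hz.2.2, inner_smul_left, hN1 hz.2.1]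
    simp
  have h12 : (2 : WithTop ℕ∞) = ((1 : ℕ) : WithTop ℕ∞) + 1 := by norm_num
  rw [h12, contDiffAt_succ_iff_hasFDerivAt]
  refine ⟨fun y => InnerProductSpace.toDual ℝ Plane (N (π y)), ⟨_, hder, fun y hy => hy⟩, ?_⟩
  have hNπ : ContDiffAt ℝ 1 (fun y => N (π y)) x :=
    ContDiffAt.comp x (g := N) (f := π) (by rw [hπx]; exact hNC hf) hπC
  exact (InnerProductSpace.toDual ℝ Plane).contDiff.contDiffAt.comp x hNπ

theorem contDiffAt_sdf_of_mem_frontier {D : Set Plane} (hc : IsClosed D)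
    (hG : IsCompact (frontier D)) (hD : HasC2Boundary D) {x : Plane} (hx : x ∈ frontier D) :
    ContDiffAt ℝ 2 (sdf D) x := by
  obtain ⟨f, hf⟩ := hD.exists_isDefiningAt hx
  refine contDiffAt_sdf_of_unique hc hG hf (isNearest_self hx)
    (fun q hq => eq_of_isNearest_self hx hq) fun v hv _ => ?_
  have : sdf D x = 0 := by rw [sdf_eq_side_mul, infDist_zero_of_mem hx, mul_zero]
  rw [this, zero_div, zero_mul, add_zero]
  have := norm_pos_iff.2 hv
  positivity

/-- Off the interface, the curvature bound for the empty ball of `x` itself would only give a weak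
inequality. Applied to the larger ball with the same contact point it gains the factor `dist x p /
dist z p < 1`, which makes the nondegeneracy condition strict. -/
theorem contDiffAt_sdf {D : Set Plane} (hc : IsClosed D) (hG : IsCompact (frontier D))
    (hne : (frontier D).Nonempty) (hD : HasC2Boundary D) {x : Plane} (hx : x ∉ medialAxis D) :
    ContDiffAt ℝ 2 (sdf D) x := by
  by_cases hxf : x ∈ frontier D
  · exact contDiffAt_sdf_of_mem_frontier hc hG hD hxf
  obtain ⟨p, hp⟩ := exists_isNearest hG hne x
  obtain ⟨f, hf⟩ := hD.exists_isDefiningAt hp.1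
  refine contDiffAt_sdf_of_unique hc hG hf hp (fun q hq => isNearest_unique hx hp hq)
    fun v hv hnv => ?_
  obtain ⟨z, hs, hz, hlt⟩ := exists_larger_ball hG hx hp hxf
  have hdpos : 0 < dist x p := dist_pos.2 fun h => hxf (h ▸ hp.1)
  have hzpos : 0 < dist z p := hdpos.trans hlt
  have hess := hf.hessian_ge hc hz hzpos hnv
  have hnpos : 0 < ‖gradient f p‖ := norm_pos_iff.2 hf.2.1
  have hvpos : 0 < ‖v‖ := norm_pos_iff.2 hv
  rw [hs] at hess
  rw [sdf_eq_side_mul, ← hp.2]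
  have h1 : dist x p / ‖gradient f p‖ * -(‖v‖ ^ 2 * ‖gradient f p‖ / dist z p) ≤
      dist x p / ‖gradient f p‖ * (side D x * ⟪fderiv ℝ (gradient f) p v, v⟫) := by gcongr
  have h2 : dist x p / ‖gradient f p‖ * -(‖v‖ ^ 2 * ‖gradient f p‖ / dist z p) =
      -(‖v‖ ^ 2 * (dist x p / dist z p)) := by field_simp
  have h3 : dist x p / dist z p < 1 := (div_lt_one hzpos).2 hlt
  have h4 : ‖v‖ ^ 2 * (dist x p / dist z p) < ‖v‖ ^ 2 * 1 := by gcongr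
  rw [h2] at h1
  have h5 : side D x * dist x p / ‖gradient f p‖ * ⟪fderiv ℝ (gradient f) p v, v⟫ =
      dist x p / ‖gradient f p‖ * (side D x * ⟪fderiv ℝ (gradient f) p v, v⟫) := by ring
  rw [h5]
  linarith

/-! ### Linear interpolation along a segment. -/

/-- The error at `a + θ w` of linear interpolation between `a` and `a + w`. -/
def lineErr (u : Plane → ℝ) (a w : Plane) (θ : ℝ) : ℝ :=
  u (a + θ • w) - ((1 - θ) * u a + θ * u (a + w))

theorem abs_lineErr_le_of_lipschitz {u : Plane → ℝ} (hu : ∀ x y, |u x - u y| ≤ dist x y)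
    (a w : Plane) {θ : ℝ} (h0 : 0 ≤ θ) (h1 : θ ≤ 1) : |lineErr u a w θ| ≤ ‖w‖ / 2 := by
  have e : lineErr u a w θ =
      (1 - θ) * (u (a + θ • w) - u a) + θ * (u (a + θ • w) - u (a + w)) := by
    unfold lineErr; ring
  have b1 : |u (a + θ • w) - u a| ≤ θ * ‖w‖ := by
    refine (hu _ _).trans_eq ?_
    rw [dist_eq_norm, add_sub_cancel_left, norm_smul, Real.norm_of_nonneg h0]
  have b2 : |u (a + θ • w) - u (a + w)| ≤ (1 - θ) * ‖w‖ := by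
    refine (hu _ _).trans_eq ?_
    have : a + w - (a + θ • w) = (1 - θ) • w := by module
    rw [dist_comm, dist_eq_norm, this, norm_smul, Real.norm_of_nonneg (by linarith)]
  rw [e]
  refine (abs_add_le _ _).trans ?_
  rw [abs_mul, abs_mul, abs_of_nonneg h0, abs_of_nonneg (by linarith : 0 ≤ 1 - θ)]
  have hw := norm_nonneg w
  nlinarith [mul_le_mul_of_nonneg_left b1 (by linarith : 0 ≤ 1 - θ),
    mul_le_mul_of_nonneg_left b2 h0, mul_nonneg hw (sq_nonneg (1 - 2 * θ))]

/-- By the mean value theorem on both sides of `θ` the error equals `θ * (1 - θ) * (g' c - g' d)`.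
Only the oscillation of `g'` enters, so the bound serves both for bounded second partial derivatives
and for a Lipschitz gradient. -/
theorem abs_interp_error_le {g g' : ℝ → ℝ} {B : ℝ}
    (hg : ∀ t ∈ Icc (0 : ℝ) 1, HasDerivAt g (g' t) t)
    (hB : ∀ s ∈ Icc (0 : ℝ) 1, ∀ t ∈ Icc (0 : ℝ) 1, |g' s - g' t| ≤ B)
    {θ : ℝ} (h0 : 0 ≤ θ) (h1 : θ ≤ 1) :
    |g θ - ((1 - θ) * g 0 + θ * g 1)| ≤ θ * (1 - θ) * B := by
  rcases h0.eq_or_lt with rfl | h0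
  · simp
  rcases h1.eq_or_lt with rfl | h1
  · simp
  obtain ⟨c, hc, hcs⟩ := exists_hasDerivAt_eq_slope g g' h0
    (fun t ht => (hg t ⟨ht.1, ht.2.trans h1.le⟩).continuousAt.continuousWithinAt)
    fun t ht => hg t ⟨ht.1.le, ht.2.le.trans h1.le⟩
  obtain ⟨d, hd, hds⟩ := exists_hasDerivAt_eq_slope g g' h1
    (fun t ht => (hg t ⟨h0.le.trans ht.1, ht.2⟩).continuousAt.continuousWithinAt)
    fun t ht => hg t ⟨h0.le.trans ht.1.le, ht.2.le⟩
  rw [eq_div_iff (by linarith)] at hcs hds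
  have e : g θ - ((1 - θ) * g 0 + θ * g 1) = θ * (1 - θ) * (g' c - g' d) := by
    linear_combination (-(1 - θ)) * hcs + θ * hds
  have hp : 0 ≤ θ * (1 - θ) := mul_nonneg h0.le (by linarith)
  rw [e, abs_mul, abs_of_nonneg hp]
  exact mul_le_mul_of_nonneg_left
    (hB c ⟨hc.1.le, hc.2.le.trans h1.le⟩ d ⟨h0.le.trans hd.1.le, hd.2.le⟩) hp

theorem hasDerivAt_add_smul (a w : Plane) (t : ℝ) : HasDerivAt (fun s : ℝ => a + s • w) w t := by
  simpa using ((hasDerivAt_id t).smul_const w).const_add a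

theorem abs_lineErr_le {u : Plane → ℝ} {a w : Plane} {B : ℝ}
    (hu : ∀ t ∈ Icc (0 : ℝ) 1, DifferentiableAt ℝ u (a + t • w))
    (hB : ∀ s ∈ Icc (0 : ℝ) 1, ∀ t ∈ Icc (0 : ℝ) 1,
      |fderiv ℝ u (a + s • w) w - fderiv ℝ u (a + t • w) w| ≤ B)
    {θ : ℝ} (h0 : 0 ≤ θ) (h1 : θ ≤ 1) : |lineErr u a w θ| ≤ θ * (1 - θ) * B := by
  have := abs_interp_error_le (g := fun t => u (a + t • w))
    (g' := fun t => fderiv ℝ u (a + t • w) w)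
    (fun t ht => (hu t ht).hasFDerivAt.comp_hasDerivAt t (hasDerivAt_add_smul a w t)) hB h0 h1
  simpa [lineErr] using this

theorem contDiffAt_partialDeriv {u : Plane → ℝ} {x : Plane} (k : Fin 2)
    (hu : ContDiffAt ℝ 2 u x) : ContDiffAt ℝ 1 (partialDeriv k u) x :=
  (hu.fderiv_right (m := 1) (by norm_num)).clm_apply contDiffAt_const

theorem continuousAt_partialDeriv_partialDeriv {u : Plane → ℝ} {x : Plane} (k : Fin 2)
    (hu : ContDiffAt ℝ 2 u x) : ContinuousAt (partialDeriv k (partialDeriv k u)) x :=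
  (((contDiffAt_partialDeriv k hu).fderiv_right (m := 0) (by norm_num)).clm_apply
    contDiffAt_const).continuousAt

theorem abs_lineErr_le_of_partialDeriv {u : Plane → ℝ} {a : Plane} {h M : ℝ} (hh : 0 ≤ h)
    (k : Fin 2)
    (hu : ∀ t ∈ Icc (0 : ℝ) 1, ContDiffAt ℝ 2 u (a + t • h • EuclideanSpace.single k (1 : ℝ)))
    (hM : ∀ t ∈ Icc (0 : ℝ) 1, |partialDeriv k (partialDeriv k u)
      (a + t • h • EuclideanSpace.single k (1 : ℝ))| ≤ M)
    {θ : ℝ} (h0 : 0 ≤ θ) (h1 : θ ≤ 1) :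
    |lineErr u a (h • EuclideanSpace.single k (1 : ℝ)) θ| ≤ h ^ 2 / 4 * M := by
  set e : Plane := EuclideanSpace.single k (1 : ℝ) with he
  have hM0 : 0 ≤ M := (abs_nonneg _).trans (hM 0 (by simp))
  have hder : ∀ s ∈ Icc (0 : ℝ) 1, ∀ t ∈ Icc (0 : ℝ) 1,
      |fderiv ℝ u (a + s • h • e) (h • e) - fderiv ℝ u (a + t • h • e) (h • e)| ≤ h ^ 2 * M := by
    intro s hs t ht
    have hd : ∀ r ∈ Icc (0 : ℝ) 1, HasDerivWithinAt
        (fun r : ℝ => partialDeriv k u (a + r • h • e))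
        (h * partialDeriv k (partialDeriv k u) (a + r • h • e)) (Icc 0 1) r := by
      intro r hr
      have h2 := ((contDiffAt_partialDeriv k (hu r hr)).differentiableAt
        (by norm_num)).hasFDerivAt.comp_hasDerivAt r (hasDerivAt_add_smul a (h • e) r)
      refine HasDerivAt.hasDerivWithinAt (h2.congr_deriv ?_)
      rw [map_smul, smul_eq_mul]
      rfl
    have hb := Convex.norm_image_sub_le_of_norm_hasDerivWithin_le (C := h * M) hd (fun r hr => by
      rw [Real.norm_eq_abs, abs_mul, abs_of_nonneg hh]
      exact mul_le_mul_of_nonneg_left (hM r hr) hh) (convex_Icc 0 1) ht hs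
    rw [Real.norm_eq_abs, Real.norm_eq_abs] at hb
    have hst : |s - t| ≤ 1 := by
      rw [abs_le]; constructor <;> linarith [hs.1, hs.2, ht.1, ht.2]
    rw [map_smul, map_smul, smul_eq_mul, smul_eq_mul, ← mul_sub, abs_mul, abs_of_nonneg hh]
    calc h * |partialDeriv k u (a + s • h • e) - partialDeriv k u (a + t • h • e)|
        ≤ h * (h * M * |s - t|) := by gcongr
      _ ≤ h * (h * M * 1) := by gcongr
      _ = h ^ 2 * M := by ring
  refine (abs_lineErr_le (fun t ht => (hu t ht).differentiableAt (by norm_num)) hder h0 h1).trans ?_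
  have : 0 ≤ h ^ 2 * M := by positivity
  nlinarith [mul_nonneg this (sq_nonneg (1 - 2 * θ))]

/-! ### Bilinear interpolation on a grid cell. -/

theorem mesh_pos {n : ℕ} (hn : 2 ≤ n) : 0 < mesh n := by
  have : (2 : ℝ) ≤ n := by exact_mod_cast hn
  exact one_div_pos.2 (by linarith)

theorem sub_one_mul_mesh {n : ℕ} (hn : 2 ≤ n) : ((n : ℝ) - 1) * mesh n = 1 := by
  have : (2 : ℝ) ≤ n := by exact_mod_cast hn
  unfold mesh
  field_simp [show (n : ℝ) - 1 ≠ 0 by linarith]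

theorem cast_pred {n : ℕ} (hn : 2 ≤ n) : ((n - 1 : ℕ) : ℝ) = (n : ℝ) - 1 := by
  rw [Nat.cast_sub (by omega), Nat.cast_one]

theorem norm_mesh_smul {n : ℕ} (hn : 2 ≤ n) (k : Fin 2) :
    ‖mesh n • (EuclideanSpace.single k (1 : ℝ) : Plane)‖ = mesh n := by
  rw [norm_smul, Real.norm_of_nonneg (mesh_pos hn).le]
  simp

theorem vec_add_smul_zero (a b t : ℝ) :
    (!₂[a, b] : Plane) + t • EuclideanSpace.single 0 (1 : ℝ) = !₂[a + t, b] := by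
  ext k
  fin_cases k <;> simp

theorem vec_add_smul_one (a b t : ℝ) :
    (!₂[a, b] : Plane) + t • EuclideanSpace.single 1 (1 : ℝ) = !₂[a, b + t] := by
  ext k
  fin_cases k <;> simp

theorem vec_eta (x : Plane) : (!₂[x 0, x 1] : Plane) = x := by
  ext k
  fin_cases k <;> simp

/-- Bilinear interpolation is linear interpolation along the two vertical edges followed by linear
interpolation across the cell at height `x 1`. -/
theorem sub_gridInterp_eq {n i j : ℕ} (hn : 2 ≤ n) (hi : i + 1 < n) (hj : j + 1 < n)
    (u : Plane → ℝ) {x : Plane} (hx : x ∈ cell n i j) :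
    u x - gridInterp n u x =
      lineErr u !₂[i * mesh n, x 1] (mesh n • EuclideanSpace.single 0 (1 : ℝ)) (x 0 / mesh n - i) +
      ((1 - (x 0 / mesh n - i)) * lineErr u (gridPoint n i j)
          (mesh n • EuclideanSpace.single 1 (1 : ℝ)) (x 1 / mesh n - j) +
        (x 0 / mesh n - i) * lineErr u (gridPoint n (i + 1) j)
          (mesh n • EuclideanSpace.single 1 (1 : ℝ)) (x 1 / mesh n - j)) := by
  have hm := (mesh_pos hn).ne'
  rw [gridInterp_eq_bilinear n i j hi hj u x hx]
  unfold lineErr gridPoint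
  simp only [smul_smul, vec_add_smul_zero, vec_add_smul_one]
  have e0 : (i : ℝ) * mesh n + (x 0 / mesh n - i) * mesh n = x 0 := by field_simp; ring
  have e1 : (j : ℝ) * mesh n + (x 1 / mesh n - j) * mesh n = x 1 := by field_simp; ring
  have e2 : (i : ℝ) * mesh n + mesh n = ((i + 1 : ℕ) : ℝ) * mesh n := by push_cast; ring
  have e3 : (j : ℝ) * mesh n + mesh n = ((j + 1 : ℕ) : ℝ) * mesh n := by push_cast; ring
  rw [e0, e1, e2, e3, vec_eta]
  ring

theorem cell_coord {n i j : ℕ} (hn : 2 ≤ n) {x : Plane} (hx : x ∈ cell n i j) :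
    (0 ≤ x 0 / mesh n - i ∧ x 0 / mesh n - i ≤ 1) ∧
      (0 ≤ x 1 / mesh n - j ∧ x 1 / mesh n - j ≤ 1) := by
  have hm := mesh_pos hn
  obtain ⟨⟨a0, a1⟩, b0, b1⟩ := hx
  have c0 := (le_div_iff₀ hm).2 a0
  have c1 := (div_le_iff₀ hm).2 a1
  have c2 := (le_div_iff₀ hm).2 b0
  have c3 := (div_le_iff₀ hm).2 b1
  refine ⟨⟨?_, ?_⟩, ?_, ?_⟩ <;> linarith

/-- Bound of the bilinear error by the errors of linear interpolation along grid lines. -/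
theorem abs_sub_gridInterp_le {n i j : ℕ} (hn : 2 ≤ n) (hi : i + 1 < n) (hj : j + 1 < n)
    {u : Plane → ℝ} {x : Plane} (hx : x ∈ cell n i j) {P Q : ℝ}
    (hP : |lineErr u !₂[i * mesh n, x 1] (mesh n • EuclideanSpace.single 0 (1 : ℝ))
      (x 0 / mesh n - i)| ≤ P)
    (hQ0 : |lineErr u (gridPoint n i j) (mesh n • EuclideanSpace.single 1 (1 : ℝ))
      (x 1 / mesh n - j)| ≤ Q)
    (hQ1 : |lineErr u (gridPoint n (i + 1) j) (mesh n • EuclideanSpace.single 1 (1 : ℝ))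
      (x 1 / mesh n - j)| ≤ Q) :
    |u x - gridInterp n u x| ≤ P + Q := by
  obtain ⟨⟨c0, c1⟩, -⟩ := cell_coord hn hx
  rw [sub_gridInterp_eq hn hi hj u hx]
  refine (abs_add_le _ _).trans (add_le_add hP ((abs_add_le _ _).trans ?_))
  rw [abs_mul, abs_mul, abs_of_nonneg c0, abs_of_nonneg (by linarith : 0 ≤ 1 - (x 0 / mesh n - i))]
  nlinarith

/-- The Lipschitz bound contributes half a mesh size in each direction, with no smoothness needed.
-/
theorem abs_encodingError_le {D : Set Plane} {n i j : ℕ} (hn : 2 ≤ n) (hi : i + 1 < n)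
    (hj : j + 1 < n) {x : Plane} (hx : x ∈ cell n i j) : |encodingError D n x| ≤ mesh n := by
  obtain ⟨⟨c0, c1⟩, d0, d1⟩ := cell_coord hn hx
  have hL := abs_sdf_sub_sdf_le D
  have key : ∀ (k : Fin 2) (a : Plane) (θ : ℝ), 0 ≤ θ → θ ≤ 1 →
      |lineErr (sdf D) a (mesh n • EuclideanSpace.single k (1 : ℝ)) θ| ≤ mesh n / 2 := by
    intro k a θ h0 h1
    have := abs_lineErr_le_of_lipschitz hL a (mesh n • EuclideanSpace.single k (1 : ℝ)) h0 h1
    rwa [norm_mesh_smul hn] at this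
  have := abs_sub_gridInterp_le hn hi hj hx (key 0 _ _ c0 c1) (key 1 _ _ d0 d1) (key 1 _ _ d0 d1)
  unfold encodingError
  linarith

theorem isClosed_cell (n i j : ℕ) : IsClosed (cell n i j) := by
  have : cell n i j = (fun x : Plane => x 0) ⁻¹' Icc ((i : ℝ) * mesh n) (((i : ℝ) + 1) * mesh n) ∩
      (fun x : Plane => x 1) ⁻¹' Icc ((j : ℝ) * mesh n) (((j : ℝ) + 1) * mesh n) := rfl
  rw [this]
  exact (isClosed_Icc.preimage (by fun_prop)).inter (isClosed_Icc.preimage (by fun_prop))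

theorem cell_subset_unitSquare {n i j : ℕ} (hn : 2 ≤ n) (hi : i + 1 < n) (hj : j + 1 < n) :
    cell n i j ⊆ unitSquare := by
  have hm := mesh_pos hn
  have h1 := sub_one_mul_mesh hn
  have key : ∀ m : ℕ, m + 1 < n → ∀ t : ℝ, m * mesh n ≤ t → t ≤ (m + 1) * mesh n →
      0 ≤ t ∧ t ≤ 1 := by
    intro m hm' t ht0 ht1
    have hm1 : (m : ℝ) + 1 ≤ n - 1 := by
      have : ((m + 1 + 1 : ℕ) : ℝ) ≤ n := by exact_mod_cast hm'
      push_cast at this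
      linarith
    refine ⟨le_trans (by positivity) ht0, ht1.trans ?_⟩
    exact (mul_le_mul_of_nonneg_right hm1 hm.le).trans_eq h1
  rintro x ⟨⟨a0, a1⟩, b0, b1⟩ k
  fin_cases k
  · exact key i hi _ a0 a1
  · exact key j hj _ b0 b1

theorem isCompact_cell {n i j : ℕ} (hn : 2 ≤ n) (hi : i + 1 < n) (hj : j + 1 < n) :
    IsCompact (cell n i j) :=
  isCompact_unitSquare.of_isClosed_subset (isClosed_cell n i j) (cell_subset_unitSquare hn hi hj)

theorem vec_mem_cell {n i j : ℕ} {a b : ℝ} : (!₂[a, b] : Plane) ∈ cell n i j ↔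
    a ∈ Icc ((i : ℝ) * mesh n) (((i : ℝ) + 1) * mesh n) ∧
      b ∈ Icc ((j : ℝ) * mesh n) (((j : ℝ) + 1) * mesh n) := by
  simp [cell]

theorem abs_sub_gridInterp_le_of_partialDeriv {n i j : ℕ} (hn : 2 ≤ n) (hi : i + 1 < n)
    (hj : j + 1 < n) {u : Plane → ℝ} (hu : ∀ x ∈ cell n i j, ContDiffAt ℝ 2 u x) {P Q : ℝ}
    (hP : ∀ x ∈ cell n i j, |partialDeriv 0 (partialDeriv 0 u) x| ≤ P)
    (hQ : ∀ x ∈ cell n i j, |partialDeriv 1 (partialDeriv 1 u) x| ≤ Q) {x : Plane}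
    (hx : x ∈ cell n i j) :
    |u x - gridInterp n u x| ≤ mesh n ^ 2 / 4 * (P + Q) := by
  have hm := mesh_pos hn
  obtain ⟨⟨c0, c1⟩, d0, d1⟩ := cell_coord hn hx
  have hx0 : ∀ t ∈ Icc (0 : ℝ) 1, (!₂[(i : ℝ) * mesh n, x 1] : Plane) +
      t • mesh n • EuclideanSpace.single 0 (1 : ℝ) ∈ cell n i j := by
    intro t ht
    rw [smul_smul, vec_add_smul_zero, vec_mem_cell]
    exact ⟨⟨by nlinarith [ht.1], by nlinarith [ht.2]⟩, hx.2⟩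
  have hx1 : ∀ m : ℕ, (m : ℝ) = i ∨ (m : ℝ) = i + 1 → ∀ t ∈ Icc (0 : ℝ) 1, gridPoint n m j +
      t • mesh n • EuclideanSpace.single 1 (1 : ℝ) ∈ cell n i j := by
    intro m hmi t ht
    rw [gridPoint, smul_smul, vec_add_smul_one, vec_mem_cell]
    refine ⟨?_, ⟨by nlinarith [ht.1], by nlinarith [ht.2]⟩⟩
    rcases hmi with h | h <;> rw [h] <;> constructor <;> nlinarith
  have := abs_sub_gridInterp_le hn hi hj hx
    (abs_lineErr_le_of_partialDeriv hm.le 0 (fun t ht => hu _ (hx0 t ht))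
      (fun t ht => hP _ (hx0 t ht)) c0 c1)
    (abs_lineErr_le_of_partialDeriv hm.le 1 (fun t ht => hu _ (hx1 i (Or.inl rfl) t ht))
      (fun t ht => hQ _ (hx1 i (Or.inl rfl) t ht)) d0 d1)
    (abs_lineErr_le_of_partialDeriv hm.le 1
      (fun t ht => hu _ (hx1 (i + 1) (Or.inr (by push_cast; rfl)) t ht))
      (fun t ht => hQ _ (hx1 (i + 1) (Or.inr (by push_cast; rfl)) t ht)) d0 d1)
  linarith

/-- The points `ξ` and `η` maximise the two pure second derivatives, which are continuous on the
compact cell. -/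
theorem exists_smooth_cell_bound {n i j : ℕ} (hn : 2 ≤ n) (hi : i + 1 < n)
    (hj : j + 1 < n) {u : Plane → ℝ} (hu : ∀ x ∈ cell n i j, ContDiffAt ℝ 2 u x) :
    ∃ ξ ∈ cell n i j, ∃ η ∈ cell n i j, ∀ x ∈ cell n i j, |u x - gridInterp n u x| ≤
      mesh n ^ 2 / 4 * (|partialDeriv 0 (partialDeriv 0 u) ξ| +
        |partialDeriv 1 (partialDeriv 1 u) η|) := by
  have hm := mesh_pos hn
  have hne : (cell n i j).Nonempty :=
    ⟨gridPoint n i j, vec_mem_cell.2 ⟨⟨le_rfl, by nlinarith⟩, ⟨le_rfl, by nlinarith⟩⟩⟩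
  have hcont : ∀ k, ContinuousOn (fun x => |partialDeriv k (partialDeriv k u) x|) (cell n i j) :=
    fun k x hx => (continuousAt_partialDeriv_partialDeriv k (hu x hx)).abs.continuousWithinAt
  obtain ⟨ξ, hξ, hξm⟩ := (isCompact_cell hn hi hj).exists_isMaxOn hne (hcont 0)
  obtain ⟨η, hη, hηm⟩ := (isCompact_cell hn hi hj).exists_isMaxOn hne (hcont 1)
  exact ⟨ξ, hξ, η, hη, fun x hx => abs_sub_gridInterp_le_of_partialDeriv hn hi hj hu
    (fun y hy => hξm hy) (fun y hy => hηm hy) hx⟩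

/-! ### Covering the square by cells and integrals over cells. -/

theorem exists_index {n : ℕ} (hn : 2 ≤ n) {t : ℝ} (h0 : 0 ≤ t) (h1 : t ≤ 1) :
    ∃ i : Fin (n - 1), (i : ℝ) * mesh n ≤ t ∧ t ≤ ((i : ℝ) + 1) * mesh n := by
  have hm := mesh_pos hn
  have hm1 := sub_one_mul_mesh hn
  -- At `t = 1` the floor would be `n - 1`, one past the last cell.
  rcases h1.eq_or_lt with rfl | h1
  · refine ⟨⟨n - 2, by omega⟩, ?_⟩
    have : ((n - 2 : ℕ) : ℝ) = n - 2 := by rw [Nat.cast_sub hn]; norm_num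
    simp only [this]
    constructor <;> nlinarith
  · have hlt : t / mesh n < n - 1 := by rw [div_lt_iff₀ hm, hm1]; exact h1
    have hfl : ⌊t / mesh n⌋₊ < n - 1 := by
      rw [Nat.floor_lt (by positivity), cast_pred hn]
      exact hlt
    refine ⟨⟨_, hfl⟩, ?_, ?_⟩
    · have := Nat.floor_le (by positivity : 0 ≤ t / mesh n)
      rwa [le_div_iff₀ hm] at this
    · have := Nat.lt_floor_add_one (t / mesh n)
      rw [div_lt_iff₀ hm] at this
      exact this.le

theorem unitSquare_subset_iUnion_cell {n : ℕ} (hn : 2 ≤ n) :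
    unitSquare ⊆ ⋃ c : Fin (n - 1) × Fin (n - 1), cell n c.1 c.2 := by
  intro x hx
  obtain ⟨i, hi⟩ := exists_index hn (hx 0).1 (hx 0).2
  obtain ⟨j, hj⟩ := exists_index hn (hx 1).1 (hx 1).2
  exact mem_iUnion.2 ⟨(i, j), hi, hj⟩

theorem volume_cell {n : ℕ} (hn : 2 ≤ n) (i j : ℕ) :
    volume (cell n i j) = ENNReal.ofReal (mesh n ^ 2) := by
  have hm := mesh_pos hn
  have e : cell n i j = (@WithLp.ofLp 2 (Fin 2 → ℝ)) ⁻¹' Icc ![(i : ℝ) * mesh n, j * mesh n]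
      ![((i : ℝ) + 1) * mesh n, ((j : ℝ) + 1) * mesh n] := by
    ext x
    simp only [cell, Set.mem_preimage, mem_Icc, Pi.le_def, Fin.forall_fin_two, Set.mem_ofPred_eq]
    simp
    tauto
  rw [e, (PiLp.volume_preserving_ofLp (Fin 2)).measure_preimage measurableSet_Icc.nullMeasurableSet,
    Real.volume_Icc_pi, Fin.prod_univ_two, ← ENNReal.ofReal_mul (by simp; nlinarith)]
  congr 1
  simp
  ring

theorem eLpNorm_two_sq {u : Plane → ℝ} (μ : Measure Plane) :
    eLpNorm u 2 μ ^ 2 = ∫⁻ x, ENNReal.ofReal (u x ^ 2) ∂μ := by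
  have h := eLpNorm_nnreal_pow_eq_lintegral (f := u) (μ := μ) (p := 2) (by norm_num)
  have e : ∀ x, ‖u x‖ₑ ^ ((2 : NNReal) : ℝ) = ENNReal.ofReal (u x ^ 2) := by
    intro x
    rw [show ((2 : NNReal) : ℝ) = ((2 : ℕ) : ℝ) by norm_num, ENNReal.rpow_natCast,
      ← ofReal_norm, ← ENNReal.ofReal_pow (norm_nonneg _), Real.norm_eq_abs, sq_abs]
  simp only [e] at h
  rw [← h, show ((2 : NNReal) : ℝ) = ((2 : ℕ) : ℝ) by norm_num, ENNReal.rpow_natCast]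
  rfl

theorem lintegral_unitSquare_le {n : ℕ} (hn : 2 ≤ n) (F : Plane → ℝ≥0∞) :
    ∫⁻ x in unitSquare, F x ≤ ∑ c : Fin (n - 1) × Fin (n - 1), ∫⁻ x in cell n c.1 c.2, F x := by
  refine (lintegral_mono_set (unitSquare_subset_iUnion_cell hn)).trans ?_
  refine (lintegral_iUnion_le _ _).trans_eq ?_
  rw [tsum_fintype]

theorem lintegral_cell_le {n : ℕ} (hn : 2 ≤ n) {i j : ℕ} {u : Plane → ℝ} {B : ℝ}
    (hB : ∀ x ∈ cell n i j, |u x| ≤ B) :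
    ∫⁻ x in cell n i j, ENNReal.ofReal (u x ^ 2) ≤ ENNReal.ofReal (B ^ 2 * mesh n ^ 2) := by
  calc ∫⁻ x in cell n i j, ENNReal.ofReal (u x ^ 2)
      ≤ ∫⁻ _ in cell n i j, ENNReal.ofReal (B ^ 2) := by
        refine setLIntegral_mono measurable_const fun x hx => ENNReal.ofReal_le_ofReal ?_
        rw [← sq_abs]
        exact pow_le_pow_left₀ (abs_nonneg _) (hB x hx) 2
    _ = _ := by rw [setLIntegral_const, volume_cell hn, ← ENNReal.ofReal_mul (sq_nonneg _)]

/-! ### Counting the cells that meet a set of finite length. -/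

/-- A neighbourhood of a grid cell of relative size one half. -/
def enlargedCell (n i j : ℕ) : Set Plane :=
  {x | x 0 ∈ Set.Icc (((i : ℝ) - 1 / 2) * mesh n) (((i : ℝ) + 3 / 2) * mesh n) ∧
    x 1 ∈ Set.Icc (((j : ℝ) - 1 / 2) * mesh n) (((j : ℝ) + 3 / 2) * mesh n)}

theorem measurableSet_enlargedCell (n i j : ℕ) : MeasurableSet (enlargedCell n i j) := by
  have h : ∀ k : Fin 2, Measurable fun x : Plane => x k := fun k =>
    Continuous.measurable (by fun_prop)
  exact (h 0 measurableSet_Icc).inter (h 1 measurableSet_Icc)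

theorem abs_coord_sub_le_dist (x y : Plane) (k : Fin 2) : |x k - y k| ≤ dist x y := by
  rw [dist_eq_norm, ← Real.norm_eq_abs]
  exact PiLp.norm_apply_le (x - y) k

theorem mem_enlargedCell_of_dist_le {n i j : ℕ} {x y : Plane} (hx : x ∈ cell n i j)
    (hy : dist y x ≤ mesh n / 2) : y ∈ enlargedCell n i j := by
  have h0 := abs_le.1 ((abs_coord_sub_le_dist y x 0).trans hy)
  have h1 := abs_le.1 ((abs_coord_sub_le_dist y x 1).trans hy)
  obtain ⟨⟨a0, a1⟩, b0, b1⟩ := hx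
  refine ⟨⟨?_, ?_⟩, ?_, ?_⟩ <;> linarith [h0.1, h0.2, h1.1, h1.2]

/-- A connected set that leaves a ball has length at least the radius in that ball. -/
theorem le_hausdorffMeasure_of_isPreconnected {S C : Set Plane} (hC : IsPreconnected C)
    (hCS : C ⊆ S) {x y : Plane} (hx : x ∈ C) (hy : y ∈ C) {r : ℝ} (hr : r ≤ dist y x) :
    ENNReal.ofReal r ≤ μH[1] (S ∩ closedBall x r) := by
  have hcont : Continuous fun z : Plane => dist z x := by fun_prop
  -- On the connected set the distance to `x` takes every value in `[0, r]`; being 1-Lipschitz, it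
  -- does not increase length.
  have himg : Icc 0 r ⊆ (fun z => dist z x) '' (S ∩ closedBall x r) := by
    intro t ht
    have hpre := hC.image _ hcont.continuousOn
    obtain ⟨z, hz, hzt⟩ := hpre.ordConnected.out (mem_image_of_mem _ hx) (mem_image_of_mem _ hy)
      (⟨by simpa using ht.1, ht.2.trans hr⟩ : t ∈ Icc (dist x x) (dist y x))
    have hzt : dist z x = t := hzt
    exact ⟨z, ⟨hCS hz, mem_closedBall.2 (hzt.le.trans ht.2)⟩, hzt⟩
  have hlip : LipschitzWith 1 fun z : Plane => dist z x := LipschitzWith.dist_left x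
  calc ENNReal.ofReal r = volume (Icc (0 : ℝ) r) := by rw [Real.volume_Icc, sub_zero]
    _ = μH[1] (Icc (0 : ℝ) r) := by rw [hausdorffMeasure_real]
    _ ≤ μH[1] ((fun z => dist z x) '' (S ∩ closedBall x r)) := measure_mono himg
    _ ≤ _ := by simpa using hlip.hausdorffMeasure_image_le zero_le_one (S ∩ closedBall x r)

theorem card_le_nine {N : ℕ} (s : Finset (Fin N × Fin N)) (a b : ℕ)
    (ha : ∀ c ∈ s, a ≤ c.1 ∧ (c.1 : ℕ) ≤ a + 2) (hb : ∀ c ∈ s, b ≤ c.2 ∧ (c.2 : ℕ) ≤ b + 2) :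
    s.card ≤ 9 := by
  have : s.card ≤ (Finset.Icc a (a + 2) ×ˢ Finset.Icc b (b + 2)).card := by
    refine Finset.card_le_card_of_injOn (fun c => ((c.1 : ℕ), (c.2 : ℕ))) ?_ ?_
    · intro c hc
      have h1 := ha c hc
      have h2 := hb c hc
      simp only [Finset.coe_product, Finset.coe_Icc, mem_prod, mem_Icc]
      exact ⟨h1, h2⟩
    · intro c _ d _ h
      simp only [Prod.mk.injEq] at h
      exact Prod.ext (Fin.ext h.1) (Fin.ext h.2)
  refine this.trans ?_
  rw [Finset.card_product, Nat.card_Icc, Nat.card_Icc]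
  have h1 : a + 2 + 1 - a = 3 := by omega
  have h2 : b + 2 + 1 - b = 3 := by omega
  rw [h1, h2]

-- An enlarged cell has side `2 * mesh n`, so a point lies in at most three of them per coordinate
-- direction, hence in at most nine.
open Classical in
theorem sum_measure_enlargedCell_le {n : ℕ} (hn : 2 ≤ n) (μ : Measure Plane)
    (s : Finset (Fin (n - 1) × Fin (n - 1))) :
    ∑ c ∈ s, μ (enlargedCell n c.1 c.2) ≤ 9 * μ univ := by
  have hm := mesh_pos hn
  calc ∑ c ∈ s, μ (enlargedCell n c.1 c.2)
      = ∑ c ∈ s, ∫⁻ x, (enlargedCell n c.1 c.2).indicator 1 x ∂μ := by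
        refine Finset.sum_congr rfl fun c _ => ?_
        rw [lintegral_indicator_one (measurableSet_enlargedCell n c.1 c.2)]
    _ = ∫⁻ x, ∑ c ∈ s, (enlargedCell n c.1 c.2).indicator 1 x ∂μ := by
        rw [lintegral_finsetSum]
        exact fun c _ => measurable_one.indicator (measurableSet_enlargedCell n c.1 c.2)
    _ ≤ ∫⁻ _, 9 ∂μ := by
        refine lintegral_mono fun x => ?_
        have e : ∑ c ∈ s, (enlargedCell n c.1 c.2).indicator (1 : Plane → ℝ≥0∞) x =
            ((s.filter fun c => x ∈ enlargedCell n c.1 c.2).card : ℝ≥0∞) := by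
          rw [Finset.card_filter]
          push_cast
          refine Finset.sum_congr rfl fun c _ => ?_
          simp [Set.indicator_apply]
        simp only [e]
        have key : ∀ (t : ℝ) (i : ℕ), t ∈ Icc (((i : ℝ) - 1 / 2) * mesh n)
            (((i : ℝ) + 3 / 2) * mesh n) →
            ⌈t / mesh n - 3 / 2⌉₊ ≤ i ∧ i ≤ ⌈t / mesh n - 3 / 2⌉₊ + 2 := by
          intro t i ht
          have h1 := (le_div_iff₀ hm).2 ht.1
          have h2 := (div_le_iff₀ hm).2 ht.2
          refine ⟨Nat.ceil_le.2 (by linarith), ?_⟩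
          have h3 := Nat.le_ceil (t / mesh n - 3 / 2)
          have : (i : ℝ) ≤ ((⌈t / mesh n - 3 / 2⌉₊ + 2 : ℕ) : ℝ) := by push_cast; linarith
          exact_mod_cast this
        have := card_le_nine (s.filter fun c => x ∈ enlargedCell n c.1 c.2)
          ⌈x 0 / mesh n - 3 / 2⌉₊ ⌈x 1 / mesh n - 3 / 2⌉₊
          (fun c hc => key _ _ (Finset.mem_filter.1 hc).2.1)
          (fun c hc => key _ _ (Finset.mem_filter.1 hc).2.2)
        exact_mod_cast this
    _ = 9 * μ univ := by rw [lintegral_const]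

open Classical in
/-- The number of cells that meet a set of finite length with finitely many components. -/
theorem card_cells_le {S : Set Plane} (hfin : μH[1] S ≠ ∞) [Finite (ConnectedComponents S)]
    {n : ℕ} (hn : 2 ≤ n) (s : Finset (Fin (n - 1) × Fin (n - 1)))
    (hs : ∀ c ∈ s, (cell n c.1 c.2 ∩ S).Nonempty) :
    (s.card : ℝ) ≤ 18 * (μH[1] S).toReal * ((n : ℝ) - 1) + 9 * Nat.card (ConnectedComponents S) := by
  have hm := mesh_pos hn
  have : Fintype (ConnectedComponents S) := Fintype.ofFinite _
  choose! x hxT hxS using hs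
  -- Cells whose chosen point has a component reaching distance `mesh n / 2`. Each carries length at
  -- least `mesh n / 2` in its enlarged cell; ninefold overlap gives the factor `18`.
  set large : Fin (n - 1) × Fin (n - 1) → Prop := fun c =>
    ∃ (hc : x c ∈ S) (y : S), y ∈ connectedComponent (⟨x c, hc⟩ : S) ∧ mesh n / 2 ≤ dist (y : Plane) (x c)
    with hlarge
  rw [← Finset.card_filter_add_card_filter_not large]
  push_cast
  refine add_le_add ?_ ?_
  · set t := s.filter large with ht
    have h1 : ∀ c ∈ t, ENNReal.ofReal (mesh n / 2) ≤
        (μH[1] : Measure Plane).restrict S (enlargedCell n c.1 c.2) := by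
      intro c hc
      obtain ⟨hcs, hcS, y, hy, hyd⟩ := Finset.mem_filter.1 hc
      rw [Measure.restrict_apply (measurableSet_enlargedCell n c.1 c.2)]
      have hpre : IsPreconnected
          (((↑) : S → Plane) '' connectedComponent (⟨x c, hcS⟩ : S)) :=
        isPreconnected_connectedComponent.image _ continuous_subtype_val.continuousOn
      refine (le_hausdorffMeasure_of_isPreconnected hpre (S := S) (by rintro _ ⟨z, _, rfl⟩; exact z.2)
        ⟨_, mem_connectedComponent, rfl⟩ ⟨y, hy, rfl⟩ hyd).trans (measure_mono ?_)
      rintro z ⟨hzS, hz⟩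
      exact ⟨mem_enlargedCell_of_dist_le (hxT c hcs) (mem_closedBall.1 hz), hzS⟩
    have h2 := (Finset.card_nsmul_le_sum t _ _ h1).trans (sum_measure_enlargedCell_le hn _ t)
    rw [Measure.restrict_apply_univ, nsmul_eq_mul] at h2
    have h3 := ENNReal.toReal_mono (ENNReal.mul_ne_top (by norm_num) hfin) h2
    rw [ENNReal.toReal_mul, ENNReal.toReal_mul, ENNReal.toReal_natCast,
      ENNReal.toReal_ofReal (by linarith)] at h3
    have h4 : (9 : ℝ≥0∞).toReal = 9 := by norm_num
    rw [h4] at h3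
    have h5 := sub_one_mul_mesh hn
    have h6 : 0 ≤ (n : ℝ) - 1 := by
      have : (2 : ℝ) ≤ n := by exact_mod_cast hn
      linarith
    have h7 := mul_le_mul_of_nonneg_right h3 h6
    have h8 : (t.card : ℝ) * (mesh n / 2) * ((n : ℝ) - 1) = t.card / 2 := by
      linear_combination (t.card / 2 : ℝ) * h5
    rw [h8] at h7
    linarith
  -- Remaining cells with the same component have chosen points less than `mesh n / 2` apart, so
  -- their indices differ by at most one from a fixed cell: nine cells per component.
  · set t := s.filter fun c => ¬ large c with ht
    have hts : ∀ c ∈ t, c ∈ s := fun c hc => (Finset.mem_filter.1 hc).1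
    set F : Fin (n - 1) × Fin (n - 1) → Option (ConnectedComponents S) := fun c =>
      if hc : x c ∈ S then some (ConnectedComponents.mk (⟨x c, hc⟩ : S)) else none with hF
    have hmaps : ∀ c ∈ t, F c ∈ (Finset.univ : Finset (ConnectedComponents S)).image some := by
      intro c hc
      simp [hF, hxS c (hts c hc)]
    have hfib : ∀ b ∈ (Finset.univ : Finset (ConnectedComponents S)).image some,
        (t.filter fun c => F c = b).card ≤ 9 := by
      intro b _
      rcases (t.filter fun c => F c = b).eq_empty_or_nonempty with hemp | ⟨c, hc⟩
      · simp [hemp]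
      obtain ⟨hct, hcb⟩ := Finset.mem_filter.1 hc
      have hnl := (Finset.mem_filter.1 hct).2
      have hcS := hxS c (hts c hct)
      have hclose : ∀ d ∈ t.filter fun c => F c = b, dist (x d) (x c) < mesh n / 2 := by
        intro d hd
        obtain ⟨hdt, hdb⟩ := Finset.mem_filter.1 hd
        have hdS := hxS d (hts d hdt)
        by_contra! hfar
        refine hnl ⟨hcS, ⟨x d, hdS⟩, ?_, hfar⟩
        have : F d = F c := hdb.trans hcb.symm
        simp only [hF, hdS, hcS, dite_true, Option.some.injEq] at this
        exact ConnectedComponents.coe_eq_coe'.1 this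
      -- For `i = 0` the truncated `i - 1` is `0`, and the window from `0` to `2` still contains
      -- every admissible `j`.
      have key : ∀ (i j : ℕ) (a b : ℝ), (i : ℝ) * mesh n ≤ a → a ≤ (i + 1) * mesh n →
          (j : ℝ) * mesh n ≤ b → b ≤ (j + 1) * mesh n → |b - a| < mesh n / 2 →
          i - 1 ≤ j ∧ j ≤ i - 1 + 2 := by
        intro i j a b h1 h2 h3 h4 h5
        have h6 := abs_lt.1 h5
        have h7 : (j : ℝ) < i + 2 := by
          by_contra! hcon
          nlinarith
        have h8 : (i : ℝ) < j + 2 := by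
          by_contra! hcon
          nlinarith
        have h9 : j < i + 2 := by exact_mod_cast h7
        have h10 : i < j + 2 := by exact_mod_cast h8
        omega
      refine card_le_nine _ ((c.1 : ℕ) - 1) ((c.2 : ℕ) - 1) (fun d hd => ?_) fun d hd => ?_
      · have h1 := hxT c (hts c hct)
        have h2 := hxT d (hts d (Finset.mem_filter.1 hd).1)
        exact key _ _ _ _ h1.1.1 h1.1.2 h2.1.1 h2.1.2
          ((abs_coord_sub_le_dist _ _ 0).trans_lt (hclose d hd))
      · have h1 := hxT c (hts c hct)
        have h2 := hxT d (hts d (Finset.mem_filter.1 hd).1)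
        exact key _ _ _ _ h1.2.1 h1.2.2 h2.2.1 h2.2.2
          ((abs_coord_sub_le_dist _ _ 1).trans_lt (hclose d hd))
    have h1 := Finset.card_le_mul_card_image_of_maps_to hmaps 9 hfib
    have h2 : ((Finset.univ : Finset (ConnectedComponents S)).image some).card ≤
        Nat.card (ConnectedComponents S) := by
      rw [Nat.card_eq_fintype_card]
      exact Finset.card_image_le
    exact_mod_cast h1.trans (Nat.mul_le_mul_left 9 h2)

/-! ### Local semiconvexity of the signed distance up to sign. -/

/-- Convexity up to a quadratic term. -/
def IsSemiconvexOn (u : Plane → ℝ) (s : Set Plane) (c : ℝ) : Prop :=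
  ∀ a w : Plane, a ∈ s → a + w ∈ s → ∀ θ : ℝ, 0 ≤ θ → θ ≤ 1 →
    lineErr u a w θ ≤ c * (θ * (1 - θ)) * ‖w‖ ^ 2

theorem IsSemiconvexOn.mono {u : Plane → ℝ} {s t : Set Plane} {c d : ℝ}
    (h : IsSemiconvexOn u t d) (hst : s ⊆ t) (hdc : d ≤ c) : IsSemiconvexOn u s c := by
  intro a w ha hw θ h0 h1
  refine (h a w (hst ha) (hst hw) θ h0 h1).trans ?_
  have : 0 ≤ θ * (1 - θ) := mul_nonneg h0 (by linarith)
  gcongr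

/-- The gradient is Lipschitz near `z`, so the slope along a segment `w` oscillates by at most `K *
‖w‖ ^ 2`. -/
theorem exists_isSemiconvexOn_of_contDiffAt {u : Plane → ℝ} {z : Plane}
    (hu : ContDiffAt ℝ 2 u z) : ∃ c r : ℝ, 0 ≤ c ∧ 0 < r ∧ IsSemiconvexOn u (ball z r) c := by
  have h1 : ContDiffAt ℝ 1 (fderiv ℝ u) z := hu.fderiv_right (by norm_num)
  obtain ⟨K, t, ht, hK⟩ := h1.exists_lipschitzOnWith
  have h2 : ∀ᶠ y in 𝓝 z, DifferentiableAt ℝ u y := by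
    filter_upwards [hu.eventually (by simp)] with y hy using hy.differentiableAt (by norm_num)
  obtain ⟨r, hr, hball⟩ := Metric.mem_nhds_iff.1 (inter_mem ht h2)
  refine ⟨K, r, K.2, hr, fun a w ha hw θ h0 h1 => ?_⟩
  have hmem : ∀ s ∈ Icc (0 : ℝ) 1, a + s • w ∈ ball z r := by
    intro s hs
    exact (convex_ball z r).add_smul_mem ha hw hs
  refine (le_abs_self _).trans ((abs_lineErr_le (B := K * ‖w‖ ^ 2)
    (fun s hs => (hball (hmem s hs)).2) ?_ h0 h1).trans_eq (by ring))
  intro s hs r' hr'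
  have hd := hK.dist_le_mul _ (hball (hmem s hs)).1 _ (hball (hmem r' hr')).1
  have hdist : dist (a + s • w) (a + r' • w) ≤ ‖w‖ := by
    rw [dist_eq_norm]
    have e : a + s • w - (a + r' • w) = (s - r') • w := by module
    have h5 : |s - r'| ≤ 1 := by
      rw [abs_le]; constructor <;> linarith [hs.1, hs.2, hr'.1, hr'.2]
    rw [e, norm_smul, Real.norm_eq_abs]
    exact mul_le_of_le_one_left (norm_nonneg w) h5
  rw [dist_eq_norm] at hd
  rw [← sub_apply, ← Real.norm_eq_abs]
  calc ‖(fderiv ℝ u (a + s • w) - fderiv ℝ u (a + r' • w)) w‖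
      ≤ ‖fderiv ℝ u (a + s • w) - fderiv ℝ u (a + r' • w)‖ * ‖w‖ :=
        ContinuousLinearMap.le_opNorm _ _
    _ ≤ K * ‖w‖ * ‖w‖ := by
        gcongr
        exact hd.trans (by gcongr)
    _ = K * ‖w‖ ^ 2 := by ring

/-- The distance to a compact set is semiconcave away from the set. -/
theorem isSemiconvexOn_neg_infDist {s : Set Plane} (hs : IsCompact s) (hne : s.Nonempty)
    {z : Plane} {ρ : ℝ} (hρ : 0 < ρ) (hz : 2 * ρ ≤ infDist z s) :
    IsSemiconvexOn (fun x => -infDist x s) (ball z ρ) (1 / (2 * ρ)) := by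
  intro a w ha hw θ h0 h1
  have hmem : a + θ • w ∈ ball z ρ := (convex_ball z ρ).add_smul_mem ha hw ⟨h0, h1⟩
  obtain ⟨q, hq⟩ := exists_isNearest hs hne (a + θ • w)
  set y := a + θ • w with hy
  set R := ‖y - q‖ with hR
  have hRd : infDist y s = R := by rw [← hq.2, dist_eq_norm]
  have hRρ : ρ ≤ R := by
    have h2 := infDist_le_infDist_add_dist (s := s) (x := z) (y := y)
    have h3 : dist z y < ρ := by rw [dist_comm]; exact mem_ball.1 hmem
    linarith
  have hRpos : 0 < R := hρ.trans_le hRρ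
  -- The distance to the single point `q` lies above the distance to `s`, and this quadratic lies
  -- above both, with equality at `y`. Its chord error is explicit, and `R ≥ ρ` makes the constant
  -- uniform.
  have hb : ∀ x : Plane, infDist x s ≤ (‖x - q‖ ^ 2 + R ^ 2) / (2 * R) := by
    intro x
    have h4 : infDist x s ≤ ‖x - q‖ := by
      rw [← dist_eq_norm]; exact infDist_le_dist_of_mem hq.1
    refine h4.trans ?_
    rw [le_div_iff₀ (by positivity)]
    nlinarith [sq_nonneg (‖x - q‖ - R)]
  have hid : (1 - θ) * ‖a - q‖ ^ 2 + θ * ‖a + w - q‖ ^ 2 = R ^ 2 + θ * (1 - θ) * ‖w‖ ^ 2 := by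
    have e1 : a + w - q = (a - q) + w := by abel
    have e2 : y - q = (a - q) + θ • w := by rw [hy]; abel
    rw [hR, e1, e2, norm_add_sq_real, norm_add_sq_real, inner_smul_right, norm_smul, mul_pow,
      Real.norm_eq_abs, sq_abs]
    ring
  have h5 : (1 - θ) * infDist a s + θ * infDist (a + w) s ≤
      R + θ * (1 - θ) * ‖w‖ ^ 2 / (2 * R) := by
    calc (1 - θ) * infDist a s + θ * infDist (a + w) s
        ≤ (1 - θ) * ((‖a - q‖ ^ 2 + R ^ 2) / (2 * R)) +
          θ * ((‖a + w - q‖ ^ 2 + R ^ 2) / (2 * R)) := by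
          have := sub_nonneg.2 h1
          gcongr
          · exact hb a
          · exact hb (a + w)
      _ = (((1 - θ) * ‖a - q‖ ^ 2 + θ * ‖a + w - q‖ ^ 2) + R ^ 2) / (2 * R) := by ring
      _ = _ := by rw [hid]; field_simp; ring
  have h6 : θ * (1 - θ) * ‖w‖ ^ 2 / (2 * R) ≤ 1 / (2 * ρ) * (θ * (1 - θ)) * ‖w‖ ^ 2 := by
    have : 0 ≤ θ * (1 - θ) := mul_nonneg h0 (by linarith)
    rw [div_eq_mul_one_div, mul_comm, ← mul_assoc]
    gcongr
  change -infDist y s - ((1 - θ) * -infDist a s + θ * -infDist (a + w) s) ≤ _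
  rw [hRd]
  linarith

/-- The property that the signed distance function is locally semiconvex or semiconcave, with
uniform constants. -/
def UniformlySemiconvex (D s : Set Plane) : Prop :=
  ∃ c δ : ℝ, 0 ≤ c ∧ 0 < δ ∧ ∀ z ∈ s, ∃ σ : ℝ, |σ| = 1 ∧
    IsSemiconvexOn (fun x => σ * sdf D x) (ball z δ) c

/-- Near the interface $\phi$ is $C^2$ and either sign works; elsewhere $-\mathrm{dist}$ is
semiconvex, which fixes `σ` as minus the side. Compactness makes the constants uniform. -/
theorem uniformlySemiconvex_unitSquare {D : Set Plane} (hc : IsClosed D)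
    (hG : IsCompact (frontier D)) (hne : (frontier D).Nonempty) (hD : HasC2Boundary D) :
    UniformlySemiconvex D unitSquare := by
  refine isCompact_unitSquare.induction_on ?_ ?_ ?_ ?_
  · exact ⟨0, 1, le_rfl, one_pos, by simp⟩
  · rintro s t hst ⟨c, δ, h1, h2, h3⟩
    exact ⟨c, δ, h1, h2, fun z hz => h3 z (hst hz)⟩
  · rintro s t ⟨c, δ, h1, h2, h3⟩ ⟨c', δ', h1', h2', h3'⟩
    refine ⟨max c c', min δ δ', h1.trans (le_max_left _ _), lt_min h2 h2', ?_⟩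
    rintro z (hz | hz)
    · obtain ⟨σ, hσ, hs⟩ := h3 z hz
      exact ⟨σ, hσ, hs.mono (ball_subset_ball (min_le_left _ _)) (le_max_left _ _)⟩
    · obtain ⟨σ, hσ, hs⟩ := h3' z hz
      exact ⟨σ, hσ, hs.mono (ball_subset_ball (min_le_right _ _)) (le_max_right _ _)⟩
  · intro x _
    have key : ∃ c r σ : ℝ, 0 ≤ c ∧ 0 < r ∧ |σ| = 1 ∧
        IsSemiconvexOn (fun x => σ * sdf D x) (ball x r) c := by
      by_cases hx : x ∈ frontier D
      · obtain ⟨c, r, h1, h2, h3⟩ := exists_isSemiconvexOn_of_contDiffAt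
          (contDiffAt_sdf_of_mem_frontier hc hG hD hx)
        exact ⟨c, r, 1, h1, h2, abs_one, by simpa using h3⟩
      · have hpos : 0 < infDist x (frontier D) :=
          (isClosed_frontier.notMem_iff_infDist_pos hne).1 hx
        set ρ := infDist x (frontier D) / 2 with hρ
        have hρ0 : 0 < ρ := by positivity
        refine ⟨1 / (2 * ρ), ρ, -side D x, by positivity, hρ0, ?_, ?_⟩
        · rcases side_eq_or D x with h | h <;> simp [h]
        · have h1 := isSemiconvexOn_neg_infDist hG hne hρ0 (z := x) (by rw [hρ]; linarith)
          have heq : ∀ y ∈ ball x ρ, -side D x * sdf D y = -infDist y (frontier D) := by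
            intro y hy
            have h2 : y ∈ ball x (infDist x (frontier D)) :=
              ball_subset_ball (by rw [hρ]; linarith) hy
            rw [sdf_eq_side_mul, side_eq_of_mem_ball h2]
            linear_combination (-infDist y (frontier D)) * side_mul_self D x
          intro a w ha hw θ h0 h1'
          have h3 := h1 a w ha hw θ h0 h1'
          unfold lineErr at h3 ⊢
          beta_reduce at h3 ⊢
          rw [heq _ ha, heq _ hw, heq _ ((convex_ball x ρ).add_smul_mem ha hw ⟨h0, h1'⟩)]
          exact h3
    obtain ⟨c, r, σ, h1, h2, h3, h4⟩ := key
    -- Halving the radius keeps balls around nearby centres inside the ball where `σ` works.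
    refine ⟨ball x (r / 2), mem_nhdsWithin_of_mem_nhds (ball_mem_nhds x (by positivity)),
      c, r / 2, h1, by positivity, fun z hz => ⟨σ, h3, h4.mono ?_ le_rfl⟩⟩
    intro y hy
    rw [mem_ball] at *
    linarith [dist_triangle y z x]

/-! ### Summation along grid lines and the rate $n^{-3/2}$. -/

theorem abs_lineErr_const_mul {u : Plane → ℝ} {σ : ℝ} (hσ : |σ| = 1) (a w : Plane) (θ : ℝ) :
    |lineErr (fun x => σ * u x) a w θ| = |lineErr u a w θ| := by
  have : lineErr (fun x => σ * u x) a w θ = σ * lineErr u a w θ := by unfold lineErr; ring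
  rw [this, abs_mul, hσ, one_mul]

/-- The interpolation error of a semiconvex function is controlled by a second difference. -/
theorem IsSemiconvexOn.abs_lineErr_le {u : Plane → ℝ} {z p w : Plane} {δ c : ℝ}
    (hu : IsSemiconvexOn u (ball z δ) c) (hc : 0 ≤ c) (h1 : p - w ∈ ball z δ)
    (h2 : p ∈ ball z δ) (h3 : p + w ∈ ball z δ) {θ : ℝ} (h0 : 0 ≤ θ) (hθ : θ ≤ 1) :
    |lineErr u p w θ| ≤ (u (p + w) - u p) - (u p - u (p - w)) + 4 * c * ‖w‖ ^ 2 := by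
  have hw : 0 ≤ c * ‖w‖ ^ 2 := by positivity
  have a1 := hu p w h2 h3 θ h0 hθ
  have a2 : -(2 * c * ‖w‖ ^ 2) ≤ (u (p + w) - u p) - (u p - u (p - w)) := by
    have e1 : p - w + (2 : ℝ) • w = p + w := by module
    have e2 : p - w + (1 / 2 : ℝ) • (2 : ℝ) • w = p := by module
    have := hu (p - w) ((2 : ℝ) • w) h1 (e1.symm ▸ h3) (1 / 2) (by norm_num) (by norm_num)
    unfold lineErr at this
    rw [e1, e2, norm_smul, mul_pow] at this
    norm_num at this
    linarith
  -- Here `p` is viewed as a point between `p - w` and `p + θ w`: extrapolating the slope on the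
  -- left bounds `u (p + θ w)` from below, which gives the lower bound for the error.
  have a3 : (1 + θ) * u p ≤ θ * u (p - w) + u (p + θ • w) + c * (θ * (1 + θ)) * ‖w‖ ^ 2 := by
    have hpos : 0 < 1 + θ := by linarith
    have e1 : p - w + (1 + θ) • w = p + θ • w := by module
    have e2 : p - w + (1 / (1 + θ)) • (1 + θ) • w = p := by
      rw [smul_smul, one_div_mul_cancel hpos.ne', one_smul, sub_add_cancel]
    have h4 : p + θ • w ∈ ball z δ := (convex_ball z δ).add_smul_mem h2 h3 ⟨h0, hθ⟩
    have := hu (p - w) ((1 + θ) • w) h1 (e1.symm ▸ h4) (1 / (1 + θ)) (by positivity)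
      ((div_le_one hpos).2 (by linarith))
    unfold lineErr at this
    rw [e1, e2, norm_smul, mul_pow, Real.norm_eq_abs, sq_abs] at this
    have h5 := mul_le_mul_of_nonneg_left this hpos.le
    have e3 : (1 + θ) * (u p - ((1 - 1 / (1 + θ)) * u (p - w) + 1 / (1 + θ) * u (p + θ • w))) =
        (1 + θ) * u p - θ * u (p - w) - u (p + θ • w) := by field_simp; ring
    have e4 : (1 + θ) * (c * (1 / (1 + θ) * (1 - 1 / (1 + θ))) * ((1 + θ) ^ 2 * ‖w‖ ^ 2)) =
        c * (θ * (1 + θ)) * ‖w‖ ^ 2 := by field_simp; ring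
    rw [e3, e4] at h5
    linarith
  have b1 : c * (θ * (1 - θ)) * ‖w‖ ^ 2 ≤ c * ‖w‖ ^ 2 := by
    have : θ * (1 - θ) ≤ 1 := by nlinarith
    nlinarith
  have b2 : c * (θ * (1 + θ)) * ‖w‖ ^ 2 ≤ c * ‖w‖ ^ 2 * (2 * θ) := by
    have : θ * (1 + θ) ≤ 2 * θ := by nlinarith
    have := mul_le_mul_of_nonneg_left this hw
    linarith
  rw [abs_le]
  constructor
  · unfold lineErr
    nlinarith
  · linarith

/-- While one sign `σ` works, the second differences telescope to a difference of two first
differences, each at most `‖w‖` by the Lipschitz bound. The condition `1 ≤ s` leaves room for the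
left neighbour of the first node. -/
theorem sum_abs_lineErr_block_le {D : Set Plane} {z a w : Plane} {δ c σ : ℝ} (hσ : |σ| = 1)
    (hu : IsSemiconvexOn (fun x => σ * sdf D x) (ball z δ) c) (hc : 0 ≤ c) {s l : ℕ} (hs : 1 ≤ s)
    (hball : ∀ m : ℕ, s ≤ m + 1 → m ≤ s + l → a + (m : ℝ) • w ∈ ball z δ)
    {θ : ℝ} (h0 : 0 ≤ θ) (hθ : θ ≤ 1) :
    ∑ m ∈ Finset.Ico s (s + l), |lineErr (sdf D) (a + (m : ℝ) • w) w θ| ≤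
      2 * ‖w‖ + 4 * c * ‖w‖ ^ 2 * l := by
  set u : Plane → ℝ := fun x => σ * sdf D x with hudef
  set P : ℕ → Plane := fun m => a + (m : ℝ) • w with hP
  have hstep : ∀ m, P (m + 1) = P m + w := by
    intro m
    simp only [hP]
    push_cast
    module
  have hlip : ∀ x y, |u x - u y| ≤ dist x y := by
    intro x y
    rw [hudef]
    simp only
    rw [← mul_sub, abs_mul, hσ, one_mul]
    exact abs_sdf_sub_sdf_le D x y
  have htel : ∀ k, k ≤ l → ∑ m ∈ Finset.Ico s (s + k), |lineErr (sdf D) (P m) w θ| ≤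
      (u (P (s + k)) - u (P (s + k - 1))) - (u (P s) - u (P (s - 1))) + 4 * c * ‖w‖ ^ 2 * k := by
    intro k
    induction k with
    | zero => intro _; simp
    | succ k ih =>
      intro hk
      rw [← add_assoc, Finset.sum_Ico_succ_top (by omega)]
      have h1 := ih (by omega)
      have hm : P (s + k - 1) = P (s + k) - w := by
        obtain ⟨m, hm⟩ : ∃ m, s + k = m + 1 := ⟨s + k - 1, by omega⟩
        rw [hm, Nat.add_sub_cancel, hstep, add_sub_cancel_right]
      have h2 := hu.abs_lineErr_le hc (p := P (s + k)) (w := w)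
        (hm ▸ hball _ (by omega) (by omega)) (hball _ (by omega) (by omega))
        (hstep (s + k) ▸ hball _ (by omega) (by omega)) h0 hθ
      rw [abs_lineErr_const_mul hσ, ← hstep, ← hm] at h2
      rw [Nat.add_sub_cancel]
      push_cast
      linarith
  have h1 := htel l le_rfl
  have h2 : ∀ m, u (P (m + 1)) - u (P m) ≤ ‖w‖ ∧ -‖w‖ ≤ u (P (m + 1)) - u (P m) := by
    intro m
    have := (hlip (P (m + 1)) (P m)).trans_eq (by rw [dist_eq_norm, hstep, add_sub_cancel_left])
    exact ⟨(abs_le.1 this).2, (abs_le.1 this).1⟩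
  have h3 := (h2 (s + l - 1)).1
  have h4 := (h2 (s - 1)).2
  rw [Nat.sub_add_cancel (by omega)] at h3 h4
  linarith

/-- Along a grid line the sum of the interpolation errors is of the order of the mesh size. -/
theorem exists_sum_abs_lineErr_le {D : Set Plane} (hD : UniformlySemiconvex D unitSquare) :
    ∃ B δ : ℝ, 0 ≤ B ∧ 0 < δ ∧ ∀ (N : ℕ) (a w : Plane), 1 ≤ N → (N : ℝ) * ‖w‖ = 1 → ‖w‖ ≤ δ →
      (∀ m : ℕ, m ≤ N → a + (m : ℝ) • w ∈ unitSquare) → ∀ θ : ℝ, 0 ≤ θ → θ ≤ 1 →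
      ∑ m ∈ Finset.range N, |lineErr (sdf D) (a + (m : ℝ) • w) w θ| ≤ B * ‖w‖ := by
  obtain ⟨c, δ', hc, hδ', hsemi'⟩ := hD
  -- The cap at `1` ensures that a block is no longer than the whole grid line.
  set δ := min δ' 1 with hδdef
  have hδ : 0 < δ := lt_min hδ' one_pos
  have hsemi : ∀ z ∈ unitSquare, ∃ σ : ℝ, |σ| = 1 ∧
      IsSemiconvexOn (fun x => σ * sdf D x) (ball z δ) c := by
    intro z hz
    obtain ⟨σ, hσ, h⟩ := hsemi' z hz
    exact ⟨σ, hσ, h.mono (ball_subset_ball (min_le_left _ _)) le_rfl⟩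
  -- At most `8 / δ` blocks cost `2 * h` each, the quadratic terms total at most `8 * c * h`, and
  -- the first interval costs less than `h`.
  refine ⟨16 / δ + 8 * c + 1, δ / 4, by positivity, by positivity, ?_⟩
  intro N a w hN hNw hwδ hmem θ h0 hθ
  set h := ‖w‖ with hh
  have hNpos : (0 : ℝ) < N := by exact_mod_cast hN
  have hpos : 0 < h := by
    by_contra! hcon
    nlinarith
  -- Block length: `q * h` lies between `δ / 4` and `δ / 2`, so a block with its two neighbouring
  -- nodes fits into a ball of radius `δ` while few blocks are needed.
  set q := ⌊δ / (2 * h)⌋₊ with hq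
  have hq1 : (q : ℝ) * h ≤ δ / 2 := by
    have := Nat.floor_le (by positivity : 0 ≤ δ / (2 * h))
    rw [le_div_iff₀ (by positivity)] at this
    linarith
  have hq2 : δ / 4 ≤ (q : ℝ) * h := by
    have := Nat.lt_floor_add_one (δ / (2 * h))
    rw [div_lt_iff₀ (by positivity)] at this
    nlinarith
  have hqpos : 0 < q := by
    rw [Nat.pos_iff_ne_zero]
    intro h5
    rw [h5] at hq2
    norm_num at hq2
    linarith
  have hqN : q ≤ N := by
    have h5 : (q : ℝ) * h ≤ N * h := by
      rw [hNw]; linarith [min_le_right δ' 1]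
    have := le_of_mul_le_mul_right h5 hpos
    exact_mod_cast this
  have hblock : ∀ s l : ℕ, 1 ≤ s → s + l ≤ N → l ≤ q →
      ∑ m ∈ Finset.Ico s (s + l), |lineErr (sdf D) (a + (m : ℝ) • w) w θ| ≤
        2 * h + 4 * c * h ^ 2 * q := by
    intro s l hs hsl hlq
    obtain ⟨σ, hσ, hsc⟩ := hsemi _ (hmem (s - 1) (by omega))
    have hb := sum_abs_lineErr_block_le hσ hsc hc (a := a) (w := w) hs (l := l) (fun m hm1 hm2 => by
      rw [mem_ball, dist_eq_norm]
      have e : a + (m : ℝ) • w - (a + ((s - 1 : ℕ) : ℝ) • w) = ((m : ℝ) - ((s - 1 : ℕ) : ℝ)) • w := by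
        module
      have h6 : ((s - 1 : ℕ) : ℝ) ≤ m := by exact_mod_cast (by omega : s - 1 ≤ m)
      have h7 : (m : ℝ) ≤ ((s - 1 : ℕ) : ℝ) + q + 1 := by
        exact_mod_cast (by omega : m ≤ s - 1 + q + 1)
      rw [e, norm_smul, Real.norm_of_nonneg (by linarith), ← hh]
      have h8 : ((m : ℝ) - ((s - 1 : ℕ) : ℝ)) * h ≤ (q + 1) * h := by
        gcongr
        linarith
      linarith) h0 hθ
    refine hb.trans ?_
    have : (l : ℝ) ≤ q := by exact_mod_cast hlq
    gcongr
  have hind : ∀ b : ℕ, ∑ m ∈ Finset.Ico 1 (min (1 + b * q) N),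
      |lineErr (sdf D) (a + (m : ℝ) • w) w θ| ≤ b * (2 * h + 4 * c * h ^ 2 * q) := by
    intro b
    induction b with
    | zero => simp [hN]
    | succ b ih =>
      set s := min (1 + b * q) N with hs
      set t := min (1 + (b + 1) * q) N with ht
      have hst : s ≤ t := min_le_min_right _ (by nlinarith)
      have hs1 : 1 ≤ s := le_min (by omega) hN
      have hlen : t - s ≤ q := by
        have : (b + 1) * q = b * q + q := by ring
        omega
      rw [← Finset.sum_Ico_consecutive _ hs1 hst]
      have h5 := hblock s (t - s) hs1 (by rw [Nat.add_sub_cancel' hst]; exact min_le_right _ _) hlen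
      rw [Nat.add_sub_cancel' hst] at h5
      push_cast
      linarith
  have hlast := hind (N / q + 1)
  have hge : N ≤ 1 + (N / q + 1) * q := by
    have h5 := Nat.div_add_mod N q
    have h6 := Nat.mod_lt N hqpos
    nlinarith
  rw [min_eq_right hge] at hlast
  -- The first interval has no left neighbour for a second difference; the Lipschitz bound suffices.
  have hfirst : |lineErr (sdf D) (a + ((0 : ℕ) : ℝ) • w) w θ| ≤ h / 2 :=
    abs_lineErr_le_of_lipschitz (abs_sdf_sub_sdf_le D) _ w h0 hθ
  rw [Finset.range_eq_Ico, ← Finset.sum_Ico_consecutive _ (Nat.zero_le 1) hN]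
  simp only [Nat.Ico_succ_singleton, Finset.sum_singleton] at hfirst ⊢
  have hb1 : ((N / q + 1 : ℕ) : ℝ) * q ≤ 2 * N := by
    have h5 := Nat.div_mul_le_self N q
    have h6 : (N / q + 1) * q ≤ 2 * N := by nlinarith
    exact_mod_cast h6
  set b : ℝ := ((N / q + 1 : ℕ) : ℝ) with hb
  have hb2 : b * (δ / 4) ≤ 2 := by
    calc b * (δ / 4) ≤ b * (q * h) := by gcongr
      _ = b * q * h := by ring
      _ ≤ 2 * N * h := by gcongr
      _ = 2 := by linarith
  have hb3 : b ≤ 8 / δ := by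
    rw [le_div_iff₀ hδ]; linarith
  have e1 : b * (2 * h + 4 * c * h ^ 2 * q) = 2 * (b * h) + 4 * c * h * (b * q * h) := by ring
  have e2 : b * q * h ≤ 2 := by
    calc b * q * h ≤ 2 * N * h := by gcongr
      _ = 2 := by linarith
  have e3 : 4 * c * h * (b * q * h) ≤ 4 * c * h * 2 := by gcongr
  have e4 : 2 * (b * h) ≤ 2 * (8 / δ * h) := by gcongr
  have e5 : (16 / δ + 8 * c + 1) * h = 2 * (8 / δ * h) + 8 * c * h + h := by ring
  rw [e5]
  linarith

theorem continuous_hat : Continuous hat := by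
  unfold hat
  fun_prop

theorem continuous_gridInterp (n : ℕ) (u : Plane → ℝ) : Continuous (gridInterp n u) := by
  have := continuous_hat
  unfold gridInterp
  fun_prop

theorem continuous_encodingError (D : Set Plane) (n : ℕ) : Continuous (encodingError D n) :=
  (continuous_sdf D).sub (continuous_gridInterp n _)

theorem add_gridPoint_apply (n i j : ℕ) (y : Plane) :
    (y + gridPoint n i j) 0 = y 0 + i * mesh n ∧ (y + gridPoint n i j) 1 = y 1 + j * mesh n := by
  simp [gridPoint]

theorem add_gridPoint_mem_cell_iff (n i j : ℕ) (y : Plane) :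
    y + gridPoint n i j ∈ cell n i j ↔ y ∈ cell n 0 0 := by
  obtain ⟨e0, e1⟩ := add_gridPoint_apply n i j y
  simp only [cell, Set.mem_ofPred_eq, mem_Icc, e0, e1, Nat.cast_zero, zero_mul, zero_add]
  constructor <;> rintro ⟨⟨h1, h2⟩, h3, h4⟩ <;>
    exact ⟨⟨by linarith, by linarith⟩, by linarith, by linarith⟩

theorem fin_add_one_lt {n : ℕ} (i : Fin (n - 1)) : (i : ℕ) + 1 < n := by
  have := i.2
  omega

/-- The squared errors at corresponding points of all cells add up to the order of the mesh. -/
theorem exists_sum_encodingError_sq_le {D : Set Plane} (hD : UniformlySemiconvex D unitSquare) :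
    ∃ C : ℝ, 0 ≤ C ∧ ∀ n : ℕ, 2 ≤ n → ∀ y ∈ cell n 0 0,
      ∑ c : Fin (n - 1) × Fin (n - 1), encodingError D n (y + gridPoint n c.1 c.2) ^ 2 ≤
        C * mesh n := by
  obtain ⟨B, δ, hB, hδ, hsum⟩ := exists_sum_abs_lineErr_le hD
  refine ⟨3 * B + 1 / δ, by positivity, fun n hn y hy => ?_⟩
  have hm := mesh_pos hn
  have hm1 := sub_one_mul_mesh hn
  have hN := cast_pred hn
  set h := mesh n with hh
  have hEle : ∀ c : Fin (n - 1) × Fin (n - 1), |encodingError D n (y + gridPoint n c.1 c.2)| ≤ h :=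
    fun c => abs_encodingError_le hn (fin_add_one_lt c.1) (fin_add_one_lt c.2)
      ((add_gridPoint_mem_cell_iff n _ _ y).2 hy)
  -- On coarse grids the pointwise bound `h` on all cells gives a total of at most `1 ≤ h / δ`.
  rcases lt_or_ge δ h with hlt | hge
  · calc ∑ c : Fin (n - 1) × Fin (n - 1), encodingError D n (y + gridPoint n c.1 c.2) ^ 2
        ≤ ∑ _c : Fin (n - 1) × Fin (n - 1), h ^ 2 := by
          refine Finset.sum_le_sum fun c _ => ?_
          rw [← sq_abs]
          exact pow_le_pow_left₀ (abs_nonneg _) (hEle c) 2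
      _ = (((n : ℝ) - 1) * h) ^ 2 := by
          rw [Finset.sum_const, nsmul_eq_mul, Finset.card_univ, Fintype.card_prod, Fintype.card_fin]
          push_cast
          rw [hN]
          ring
      _ = 1 := by rw [hm1, one_pow]
      _ ≤ 1 / δ * h := by rw [one_div, inv_mul_eq_div, le_div_iff₀ hδ]; linarith
      _ ≤ (3 * B + 1 / δ) * h := by
          have : 0 ≤ 3 * B * h := by positivity
          linarith
  set w0 : Plane := h • EuclideanSpace.single 0 (1 : ℝ) with hw0
  set w1 : Plane := h • EuclideanSpace.single 1 (1 : ℝ) with hw1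
  have hn0 : ‖w0‖ = h := norm_mesh_smul hn 0
  have hn1 : ‖w1‖ = h := norm_mesh_smul hn 1
  obtain ⟨⟨y0, y0'⟩, y1, y1'⟩ := hy
  simp only [Nat.cast_zero, zero_mul, zero_add, one_mul] at y0 y0' y1 y1'
  have hθ0 : 0 ≤ y 0 / h := by positivity
  have hθ1 : y 0 / h ≤ 1 := (div_le_one hm).2 y0'
  have hs0 : 0 ≤ y 1 / h := by positivity
  have hs1 : y 1 / h ≤ 1 := (div_le_one hm).2 y1'
  set X : ℕ → ℕ → ℝ := fun i j =>
    |lineErr (sdf D) (!₂[0, y 1 + j * h] + (i : ℝ) • w0) w0 (y 0 / h)| with hX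
  set Y : ℕ → ℕ → ℝ := fun i j =>
    |lineErr (sdf D) (!₂[i * h, 0] + (j : ℝ) • w1) w1 (y 1 / h)| with hY
  have hle1 : ∀ m : ℕ, m ≤ n - 1 → 0 ≤ (m : ℝ) * h ∧ (m : ℝ) * h ≤ 1 := by
    intro m hmn
    refine ⟨by positivity, ?_⟩
    rw [← hm1, ← hN]
    have : (m : ℝ) ≤ ((n - 1 : ℕ) : ℝ) := by exact_mod_cast hmn
    gcongr
  have hXsum : ∀ j : Fin (n - 1), ∑ i : Fin (n - 1), X i j ≤ B * h := by
    intro j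
    rw [Fin.sum_univ_eq_sum_range (fun i => X i j) (n - 1), ← hn0]
    refine hsum (n - 1) _ w0 (by omega) (by rw [hn0, hN, hm1]) (by rw [hn0]; exact hge) ?_ _ hθ0 hθ1
    intro m hmn
    have hj := hle1 (j + 1) (by have := j.2; omega)
    have hj0 := hle1 j (by have := j.2; omega)
    push_cast at hj
    have hi := hle1 m hmn
    rw [hw0, smul_smul, vec_add_smul_zero]
    intro k
    fin_cases k
    · simpa using hi
    · change y 1 + j * h ∈ Icc (0 : ℝ) 1
      constructor <;> linarith [hj.2, hj0.1]
  have hYsum : ∀ i : ℕ, i ≤ n - 1 → ∑ j : Fin (n - 1), Y i j ≤ B * h := by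
    intro i hin
    rw [Fin.sum_univ_eq_sum_range (fun j => Y i j) (n - 1), ← hn1]
    refine hsum (n - 1) _ w1 (by omega) (by rw [hn1, hN, hm1]) (by rw [hn1]; exact hge) ?_ _ hs0 hs1
    intro m hmn
    have hi := hle1 m hmn
    have hi' := hle1 i hin
    rw [hw1, smul_smul, vec_add_smul_one]
    intro k
    fin_cases k
    · exact ⟨hi'.1, hi'.2⟩
    · simpa using hi
  -- One factor of the square is bounded by `h`, the other by the line errors, which are summable
  -- along lines. Each of the three families sums to at most `B * h` on each of `n - 1` lines.
  have hpt : ∀ i j : Fin (n - 1), encodingError D n (y + gridPoint n i j) ^ 2 ≤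
      h * (X i j + (Y i j + Y (i + 1) j)) := by
    intro i j
    have hcell : y + gridPoint n i j ∈ cell n i j := by
      rw [add_gridPoint_mem_cell_iff]
      simp only [cell, Set.mem_ofPred_eq, mem_Icc, Nat.cast_zero, zero_mul, zero_add, one_mul]
      exact ⟨⟨y0, y0'⟩, y1, y1'⟩
    obtain ⟨e0, e1⟩ := add_gridPoint_apply n i j y
    have hc0 : (y + gridPoint n i j) 0 / h - i = y 0 / h := by
      rw [e0, ← hh]; field_simp; ring
    have hc1 : (y + gridPoint n i j) 1 / h - j = y 1 / h := by
      rw [e1, ← hh]; field_simp; ring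
    have hYn : ∀ i j : ℕ, 0 ≤ Y i j := fun i j => abs_nonneg _
    have hg : ∀ i j : ℕ, gridPoint n i j = !₂[i * h, 0] + (j : ℝ) • w1 := by
      intro i j
      rw [hw1, smul_smul, vec_add_smul_one, zero_add, gridPoint]
    have hE := abs_sub_gridInterp_le hn (fin_add_one_lt i) (fin_add_one_lt j) (u := sdf D) hcell
      (P := X i j) (Q := Y i j + Y (i + 1) j)
      (by
        rw [hc0, e1, hX, hw0]
        beta_reduce
        rw [smul_smul, vec_add_smul_zero, zero_add])
      (by rw [hc1, hg]; exact le_add_of_nonneg_right (hYn _ _))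
      (by rw [hc1, hg]; exact le_add_of_nonneg_left (hYn _ _))
    have hE' : |encodingError D n (y + gridPoint n i j)| ≤ X i j + (Y i j + Y (i + 1) j) := hE
    rw [← sq_abs, sq]
    exact mul_le_mul (hEle (i, j)) hE' (abs_nonneg _) hm.le
  calc ∑ c : Fin (n - 1) × Fin (n - 1), encodingError D n (y + gridPoint n c.1 c.2) ^ 2
      ≤ ∑ c : Fin (n - 1) × Fin (n - 1), h * (X c.1 c.2 + (Y c.1 c.2 + Y (c.1 + 1) c.2)) :=
        Finset.sum_le_sum fun c _ => hpt c.1 c.2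
    _ = h * (∑ j : Fin (n - 1), ∑ i : Fin (n - 1), X i j +
        (∑ i : Fin (n - 1), ∑ j : Fin (n - 1), Y i j +
          ∑ i : Fin (n - 1), ∑ j : Fin (n - 1), Y (i + 1) j)) := by
        rw [← Finset.mul_sum, Finset.sum_add_distrib, Finset.sum_add_distrib,
          Fintype.sum_prod_type_right, Fintype.sum_prod_type, Fintype.sum_prod_type]
    _ ≤ h * (∑ _j : Fin (n - 1), B * h +
        (∑ _i : Fin (n - 1), B * h + ∑ _i : Fin (n - 1), B * h)) := by
        gcongr with j _ i _ i _
        · exact hXsum j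
        · exact hYsum i (by have := i.2; omega)
        · exact hYsum (i + 1) (by have := i.2; omega)
    _ = 3 * B * h * (((n : ℝ) - 1) * h) := by
        rw [Finset.sum_const, nsmul_eq_mul, Finset.card_univ, Fintype.card_fin, hN]
        ring
    _ = 3 * B * h := by rw [hm1, mul_one]
    _ ≤ (3 * B + 1 / δ) * h := by
        have : 0 ≤ 1 / δ * h := by positivity
        linarith

theorem lintegral_cell_eq_translate (n i j : ℕ) (F : Plane → ℝ≥0∞) :
    ∫⁻ x in cell n i j, F x = ∫⁻ y in cell n 0 0, F (y + gridPoint n i j) := by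
  have h := (measurePreserving_add_right (volume : Measure Plane)
    (gridPoint n i j)).setLIntegral_comp_preimage_emb
    (measurableEmbedding_addRight (gridPoint n i j)) F (cell n i j)
  rw [← h]
  congr 2
  ext y
  exact add_gridPoint_mem_cell_iff n i j y

/-- The line estimate holds for a fixed relative position `θ`. Translating all cells to the one at
the origin therefore puts the sum inside the integral, and the cell area supplies the remaining
`mesh n ^ 2`. -/
theorem exists_lintegral_unitSquare_le {D : Set Plane} (hD : UniformlySemiconvex D unitSquare) :
    ∃ C : ℝ, 0 ≤ C ∧ ∀ n : ℕ, 2 ≤ n →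
      ∫⁻ x in unitSquare, ENNReal.ofReal (encodingError D n x ^ 2) ≤
        ENNReal.ofReal (C * mesh n ^ 3) := by
  obtain ⟨C, hC, hsum⟩ := exists_sum_encodingError_sq_le hD
  refine ⟨C, hC, fun n hn => ?_⟩
  have hm := mesh_pos hn
  refine (lintegral_unitSquare_le hn _).trans ?_
  simp only [lintegral_cell_eq_translate n _ _ fun x => ENNReal.ofReal (encodingError D n x ^ 2)]
  rw [← lintegral_finsetSum]
  · calc ∫⁻ y in cell n 0 0, ∑ c : Fin (n - 1) × Fin (n - 1),
          ENNReal.ofReal (encodingError D n (y + gridPoint n c.1 c.2) ^ 2)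
        ≤ ∫⁻ _ in cell n 0 0, ENNReal.ofReal (C * mesh n) := by
          refine setLIntegral_mono measurable_const fun y hy => ?_
          rw [← ENNReal.ofReal_sum_of_nonneg fun c _ => sq_nonneg _]
          exact ENNReal.ofReal_le_ofReal (hsum n hn y hy)
      _ = ENNReal.ofReal (C * mesh n ^ 3) := by
          rw [setLIntegral_const, volume_cell hn, ← ENNReal.ofReal_mul (by positivity)]
          congr 1
          ring
  · intro c _
    have := continuous_encodingError D n
    exact ENNReal.measurable_ofReal.comp (Continuous.measurable (by fun_prop))

theorem mesh_le_two_div {n : ℕ} (hn : 2 ≤ n) : mesh n ≤ 2 / n := by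
  have : (2 : ℝ) ≤ n := by exact_mod_cast hn
  unfold mesh
  rw [div_le_div_iff₀ (by linarith) (by linarith)]
  linarith

theorem exists_eLpNorm_encodingError_le {D : Set Plane} (hD : UniformlySemiconvex D unitSquare) :
    ∃ C : ℝ, 0 < C ∧ ∀ n : ℕ, 2 ≤ n →
      eLpNorm (encodingError D n) 2 (volume.restrict unitSquare) ≤
        ENNReal.ofReal (C * (n : ℝ) ^ (-(3 / 2) : ℝ)) := by
  obtain ⟨C, hC, hint⟩ := exists_lintegral_unitSquare_le hD
  -- The `8` comes from `mesh n ≤ 2 / n` cubed; the `1` keeps the constant positive.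
  refine ⟨√(8 * C + 1), by positivity, fun n hn => ?_⟩
  have hnpos : (0 : ℝ) < n := by exact_mod_cast (by omega : 0 < n)
  have hm := mesh_pos hn
  rw [← ENNReal.pow_le_pow_left_iff two_ne_zero, eLpNorm_two_sq, ← ENNReal.ofReal_pow (by positivity)]
  refine (hint n hn).trans (ENNReal.ofReal_le_ofReal ?_)
  have e : ((n : ℝ) ^ (-(3 / 2) : ℝ)) ^ 2 = 1 / (n : ℝ) ^ 3 := by
    rw [← Real.rpow_natCast, ← Real.rpow_mul hnpos.le, one_div, ← Real.rpow_natCast,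
      ← Real.rpow_neg hnpos.le]
    norm_num
  rw [mul_pow, Real.sq_sqrt (by positivity), e]
  calc C * mesh n ^ 3 ≤ C * (2 / n) ^ 3 := by
        gcongr
        exact mesh_le_two_div hn
    _ = 8 * C * (1 / (n : ℝ) ^ 3) := by field_simp; ring
    _ ≤ (8 * C + 1) * (1 / (n : ℝ) ^ 3) := by gcongr; linarith

/-! ### Combining smooth and singular cells. -/

theorem lintegral_unitSquare_le_of_cells {n : ℕ} (hn : 2 ≤ n) {u : Plane → ℝ}
    (s : Finset (Fin (n - 1) × Fin (n - 1))) {a b : ℝ} (hb : 0 ≤ b)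
    (ha : ∀ c ∈ s, ∫⁻ x in cell n c.1 c.2, ENNReal.ofReal (u x ^ 2) ≤ ENNReal.ofReal a)
    (hab : ∀ c ∉ s, ∫⁻ x in cell n c.1 c.2, ENNReal.ofReal (u x ^ 2) ≤ ENNReal.ofReal b) (ha0 : 0 ≤ a) :
    ∫⁻ x in unitSquare, ENNReal.ofReal (u x ^ 2) ≤
      ENNReal.ofReal (s.card * a + ((n : ℝ) - 1) ^ 2 * b) := by
  classical
  refine (lintegral_unitSquare_le hn _).trans ?_
  rw [← Finset.sum_add_sum_compl s, ENNReal.ofReal_add (by positivity) (by positivity)]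
  refine add_le_add ?_ ?_
  · refine (Finset.sum_le_card_nsmul s _ _ ha).trans_eq ?_
    rw [nsmul_eq_mul, ENNReal.ofReal_mul (by positivity), ENNReal.ofReal_natCast]
  · refine (Finset.sum_le_card_nsmul sᶜ _ _ fun c hc => hab c (Finset.mem_compl.1 hc)).trans ?_
    rw [nsmul_eq_mul, ← ENNReal.ofReal_natCast, ← ENNReal.ofReal_mul (by positivity)]
    refine ENNReal.ofReal_le_ofReal ?_
    have h1 : (sᶜ.card : ℝ) ≤ ((n : ℝ) - 1) ^ 2 := by
      have h2 := Finset.card_le_univ sᶜ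
      rw [Fintype.card_prod, Fintype.card_fin] at h2
      rw [← cast_pred hn, sq]
      exact_mod_cast h2
    gcongr

theorem ncard_singularCells_le {D : Set Plane} (hfin : μH[1] (medialAxisInSquare D) ≠ ∞)
    (hcomp : Finite (ConnectedComponents (medialAxisInSquare D))) {n : ℕ} (hn : 2 ≤ n) :
    ((singularCells D n).ncard : ℝ) ≤ 18 * (medialLength D * ((n : ℝ) - 1) + medialComponents D) := by
  have hS := Set.toFinite (singularCells D n)
  have h := card_cells_le hfin hn hS.toFinset fun c hc => by
    obtain ⟨x, hx, hxM⟩ := hS.mem_toFinset.1 hc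
    exact ⟨x, hx, hxM, cell_subset_unitSquare hn (fin_add_one_lt c.1) (fin_add_one_lt c.2) hx⟩
  rw [Set.ncard_eq_toFinset_card _ hS]
  have h2 : (0 : ℝ) ≤ medialComponents D := Nat.cast_nonneg _
  unfold medialComponents medialLength at *
  linarith

end SDFEncoding

theorem mainTheorem5 :
    -- an absolute constant, independent of the region and of the grid
    ∃ A : ℝ, 0 < A ∧
      ∀ D : Set SDFEncoding.Plane, IsClosed D → D.Nonempty → D ⊆ SDFEncoding.unitSquare →
        SDFEncoding.HasC2Boundary D →
        μH[1] (SDFEncoding.medialAxisInSquare D) ≠ ∞ →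
        Finite (ConnectedComponents (SDFEncoding.medialAxisInSquare D)) →
        -- the root mean square error is `O(n ^ (-3/2))`
        (∃ C : ℝ, 0 < C ∧ ∀ n : ℕ, 2 ≤ n →
          eLpNorm (SDFEncoding.encodingError D n) 2 (volume.restrict SDFEncoding.unitSquare) ≤
            ENNReal.ofReal (C * (n : ℝ) ^ (-(3 / 2) : ℝ))) ∧
        ∀ n : ℕ, 2 ≤ n →
          -- smooth cells: second-order estimate
          (∀ c : Fin (n - 1) × Fin (n - 1), c ∉ SDFEncoding.singularCells D n →
            (∀ x ∈ SDFEncoding.cell n c.1 c.2, ContDiffAt ℝ 2 (SDFEncoding.sdf D) x) ∧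
            ∃ ξ ∈ SDFEncoding.cell n c.1 c.2, ∃ η ∈ SDFEncoding.cell n c.1 c.2,
              ∀ x ∈ SDFEncoding.cell n c.1 c.2,
                |SDFEncoding.encodingError D n x| ≤ SDFEncoding.mesh n ^ 2 / 2 *
                  (|SDFEncoding.partialDeriv 0 (SDFEncoding.partialDeriv 0 (SDFEncoding.sdf D)) ξ| +
                   |SDFEncoding.partialDeriv 1 (SDFEncoding.partialDeriv 1 (SDFEncoding.sdf D)) η|)) ∧
          -- the number of singular cells
          ((SDFEncoding.singularCells D n).ncard : ℝ) ≤
            A * (SDFEncoding.medialLength D * ((n : ℝ) - 1) + SDFEncoding.medialComponents D) ∧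
          -- each singular cell contributes `O(h ^ 4)` to the squared error
          (∀ c ∈ SDFEncoding.singularCells D n,
            eLpNorm (SDFEncoding.encodingError D n) 2
                (volume.restrict (SDFEncoding.cell n c.1 c.2)) ^ 2 ≤
              ENNReal.ofReal (A * SDFEncoding.mesh n ^ 4)) ∧
          -- the resulting bound for the whole square, with explicit dependence of the constants
          (∀ K : ℝ,
            (∀ c : Fin (n - 1) × Fin (n - 1), c ∉ SDFEncoding.singularCells D n →
              ∀ x ∈ SDFEncoding.cell n c.1 c.2,
                |SDFEncoding.partialDeriv 0 (SDFEncoding.partialDeriv 0 (SDFEncoding.sdf D)) x| +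
                |SDFEncoding.partialDeriv 1 (SDFEncoding.partialDeriv 1 (SDFEncoding.sdf D)) x|
                  ≤ K) →
            eLpNorm (SDFEncoding.encodingError D n) 2
                (volume.restrict SDFEncoding.unitSquare) ^ 2 ≤
              ENNReal.ofReal
                (A * (SDFEncoding.medialLength D * ((n : ℝ) - 1) + SDFEncoding.medialComponents D) *
                    SDFEncoding.mesh n ^ 4 +
                  ((n : ℝ) - 1) ^ 2 * (K / 2) ^ 2 * SDFEncoding.mesh n ^ 6)) := by
  -- The value `18` comes from the count of singular cells; for the error on a single cell `1` would
  -- do.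
  refine ⟨18, by norm_num, fun D hc hne hQ hD hfin hcomp => ?_⟩
  have hG := SDFEncoding.isCompact_frontier hc hQ
  have hGne := SDFEncoding.nonempty_frontier hne hQ
  refine ⟨SDFEncoding.exists_eLpNorm_encodingError_le
    (SDFEncoding.uniformlySemiconvex_unitSquare hc hG hGne hD), fun n hn => ?_⟩
  have hm := SDFEncoding.mesh_pos hn
  have hlt := fun i : Fin (n - 1) => SDFEncoding.fin_add_one_lt i
  have hsmooth : ∀ c : Fin (n - 1) × Fin (n - 1), c ∉ SDFEncoding.singularCells D n →
      ∀ x ∈ SDFEncoding.cell n c.1 c.2, ContDiffAt ℝ 2 (SDFEncoding.sdf D) x :=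
    fun c hcs x hx => SDFEncoding.contDiffAt_sdf hc hG hGne hD fun hxM => hcs ⟨x, hx, hxM⟩
  have hsing : ∀ c : Fin (n - 1) × Fin (n - 1),
      ∫⁻ x in SDFEncoding.cell n c.1 c.2, ENNReal.ofReal (SDFEncoding.encodingError D n x ^ 2) ≤
        ENNReal.ofReal (SDFEncoding.mesh n ^ 4) := fun c =>
    (SDFEncoding.lintegral_cell_le hn fun x hx =>
      SDFEncoding.abs_encodingError_le hn (hlt c.1) (hlt c.2) hx).trans_eq (by congr 1; ring)
  have hcard := SDFEncoding.ncard_singularCells_le hfin hcomp hn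
  refine ⟨fun c hcs => ⟨hsmooth c hcs, ?_⟩, hcard, fun c _ => ?_, fun K hK => ?_⟩
  · obtain ⟨ξ, hξ, η, hη, h⟩ :=
      SDFEncoding.exists_smooth_cell_bound hn (hlt c.1) (hlt c.2) (hsmooth c hcs)
    refine ⟨ξ, hξ, η, hη, fun x hx => (h x hx).trans ?_⟩
    gcongr
    norm_num
  · rw [SDFEncoding.eLpNorm_two_sq]
    refine (hsing c).trans (ENNReal.ofReal_le_ofReal ?_)
    have : 0 ≤ SDFEncoding.mesh n ^ 4 := by positivity
    linarith
  · rw [SDFEncoding.eLpNorm_two_sq]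
    have hS := Set.toFinite (SDFEncoding.singularCells D n)
    refine (SDFEncoding.lintegral_unitSquare_le_of_cells hn hS.toFinset
      (a := SDFEncoding.mesh n ^ 4) (b := (K / 2) ^ 2 * SDFEncoding.mesh n ^ 6) (by positivity)
      (fun c _ => hsing c) (fun c hcs => ?_) (by positivity)).trans (ENNReal.ofReal_le_ofReal ?_)
    · have hcs' : c ∉ SDFEncoding.singularCells D n := fun h => hcs (hS.mem_toFinset.2 h)
      -- Each second derivative is separately at most `K`, so the pointwise error is at most `mesh n
      -- ^ 2 / 4 * (K + K)`, which is the stated `K / 2` times `mesh n ^ 2`.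
      refine (SDFEncoding.lintegral_cell_le hn fun x hx =>
        SDFEncoding.abs_sub_gridInterp_le_of_partialDeriv hn (hlt c.1) (hlt c.2) (hsmooth c hcs')
          (P := K) (Q := K) (fun y hy => ?_) (fun y hy => ?_) hx).trans_eq ?_
      · exact (le_add_of_nonneg_right (abs_nonneg _)).trans (hK c hcs' y hy)
      · exact (le_add_of_nonneg_left (abs_nonneg _)).trans (hK c hcs' y hy)
      · congr 1
        ring
    · rw [← Set.ncard_eq_toFinset_card _ hS, mul_assoc (((n : ℝ) - 1) ^ 2)]
      gcongr
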